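/- Let $D$ be a division algebra that is finite dimensional over its center $F$, let $G=D^\times$, and let $N$ be a normal subgroup of $G$ such that $G^*=G/N$ is a nonabelian finite simple group. For $a\in G$ write $a^*=Na\in G^*$, and put $N(a)=\{n\in N: a+n\in N\}$. Let $\nu:G\to F^\times$ be the reduced norm and $\mathbb O=\{a\in G:\nu(a)=1\}$. Let $\Delta$ be the commuting graph of $G^*$ (vertices: the elements of $G^*\setminus\{1\}$; edges: pairs of distinct commuting elements), with distance $d$ (infinite between different components). Call $\Delta$ *balanced* if there are vertices $x,y$ such that $xy$ and $x^{-1}y$ are vertices and $d(x,y)$, $d(x,xy)$, $d(y,xy)$, $d(x,x^{-1}y)$, $d(y,x^{-1}y)$ are all greater than $3$. For $x\in G^*\setminus\{1\}$ let $\mathbb P_x=\{a\in G: a^*=x,\ 1\in N(a)\}$, $\mathbb N_x=\{n\in N: n\in N(a)\text{ for all }a\in\mathbb P_x\}$ and $\mathbb O_x=\{a\in G: a^*=x,\ -1\notin N(a)\cup N(a^{-1})\}$. For a conjugacy class $X\subseteq G^*\setminus\{1\}$ let $\mathbb P_X=\bigcup_{x\in X}\mathbb P_x$, $\mathbb N_X=\bigcap_{x\in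 X}\mathbb N_x$, $U_X=\{n\in N: n,n^{-1}\in\mathbb N_X\}$, $\mathbb M_X=\mathbb N_X\setminus U_X$, and $$\hat K_X=\{a\in \mathbb O U_X\setminus N:\ N(a)\supseteq\mathbb M_X\}.$$ A nonempty subset $S\subsetneq N$ that is invariant under conjugation by $G$ satisfies the *$U$-Hypothesis* if $1,-1\in S$, $S\cdot S=S$, and $\bar n+1\in S$, $\bar n-1\in N$ for all $\bar n\in N\setminus S$. **Theorem.** (i) Suppose that $\operatorname{diam}(\Delta)>4$. Then there are conjugacy classes $A,B\subseteq G^*\setminus\{1\}$ such that $\mathbb N_B$ satisfies the $U$-Hypothesis and for every $b\in\mathbb P_B$ there is $a\in\mathbb P_A$ with $d(a^*,b^*)>4$ and $N(a)\subseteq N(b)$. For every such choice of $A,B$, $\hat K_B\neq\emptyset$. (ii) Suppose that $\Delta$ is balanced. Then there is a conjugacy class $C\subseteq G^*\setminus\{1\}$ such that $\mathbb N_C$ satisfies the $U$-Hypothesis and, in addition, either $\mathbb O_x=\emptyset$ for some $x\in G^*\setminus\{1\}$, or for every $m\in\mathbb M_C$ there is $z\in C$ with $m\in N(z_1)$ for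 all $z_1\in\mathbb O_z$. For every such choice of $C$, $\hat K_C\neq\emptyset$. -/

import Mathlib

open scoped TensorProduct Pointwise

namespace DivQuot

section ReducedNorm

theorem repr_mul_right {F D K ι : Type*} [Field F] [DivisionRing D] [Algebra F D] [Field K]
    [Algebra F K] (b : Module.Basis ι F K) (x : D ⊗[F] K) (d : D) (i : ι) :
    (Algebra.TensorProduct.basis D b).repr (x * (d ⊗ₜ[F] (1 : K))) i =
      (Algebra.TensorProduct.basis D b).repr x i * d := by
  induction x using TensorProduct.induction_on with
  | zero => simp
  | tmul a k =>
    rw [Algebra.TensorProduct.tmul_mul_tmul, mul_one, Algebra.TensorProduct.basis_repr_tmul,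
      Algebra.TensorProduct.basis_repr_tmul]
    simp only [Finsupp.smul_apply, Finsupp.mapRange_apply, smul_eq_mul, mul_assoc]
    rw [Algebra.commutes]
  | add x y hx hy => rw [add_mul, map_add, Finsupp.add_apply, hx, hy, map_add, Finsupp.add_apply,
      add_mul]

theorem smul_eq_tmul_mul {F D K : Type*} [Field F] [DivisionRing D] [Algebra F D] [Field K]
    [Algebra F K] (d : D) (x : D ⊗[F] K) : d • x = (d ⊗ₜ[F] (1 : K)) * x := by
  induction x using TensorProduct.induction_on with
  | zero => simp
  | tmul a k => simp [TensorProduct.smul_tmul']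
  | add u v hu hv => rw [smul_add, mul_add, hu, hv]

/-- A central division algebra stays simple after extension of the ground field. -/
theorem isSimpleRing_tensor (F D K : Type*) [Field F] [DivisionRing D] [Algebra F D]
    [Algebra.IsCentral F D] [Field K] [Algebra F K] : IsSimpleRing (D ⊗[F] K) := by
  classical
  let b := Module.Basis.ofVectorSpace F K
  let B := Algebra.TensorProduct.basis D b
  refine .of_eq_bot_or_eq_top fun I => ?_
  rw [or_iff_not_imp_left]
  intro hI
  obtain ⟨x₀, hx₀, hx₀'⟩ : ∃ x ∈ I, x ≠ 0 := by
    by_contra! h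
    exact hI (by ext x; rw [TwoSidedIdeal.mem_bot]
                 exact ⟨h x, fun hx => hx ▸ I.zero_mem⟩)
  have hex : ∃ n, ∃ x ∈ I, x ≠ 0 ∧ (B.repr x).support.card = n := ⟨_, x₀, hx₀, hx₀', rfl⟩
  obtain ⟨x, hxI, hx0, hxn⟩ := Nat.find_spec hex
  have hmin : ∀ y ∈ I, (B.repr y).support.card < (B.repr x).support.card → y = 0 := by
    intro y hy hlt
    by_contra h0
    exact Nat.find_min hex (hxn ▸ hlt) ⟨y, hy, h0, rfl⟩
  obtain ⟨i, hi⟩ : ∃ i, B.repr x i ≠ 0 := by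
    by_contra! h
    exact hx0 (B.repr.map_eq_zero_iff.1 (Finsupp.ext h))
  set c := B.repr x i with hc
  let y : D ⊗[F] K := c⁻¹ • x
  have hyr : ∀ j, B.repr y j = c⁻¹ * B.repr x j := fun j => by simp [y]
  have hyI : y ∈ I := by
    rw [show y = (c⁻¹ ⊗ₜ[F] (1 : K)) * x from smul_eq_tmul_mul _ _]
    exact I.mul_mem_left _ _ hxI
  have hsupp : (B.repr y).support = (B.repr x).support := by
    ext j; simp [hyr, hi]
  have hcomm : ∀ (d : D) (j), d * B.repr y j = B.repr y j * d := by
    intro d j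
    have hl : d • y = (d ⊗ₜ[F] (1 : K)) * y := smul_eq_tmul_mul d y
    have hz : d • y - y * (d ⊗ₜ[F] (1 : K)) = 0 := by
      apply hmin
      · rw [hl]; exact I.sub_mem (I.mul_mem_left _ _ hyI) (I.mul_mem_right _ _ hyI)
      · rw [← hsupp]
        apply Finset.card_lt_card
        have hr : ∀ j, B.repr (d • y - y * (d ⊗ₜ[F] (1 : K))) j =
            d * B.repr y j - B.repr y j * d := fun j => by
          rw [map_sub, Finsupp.sub_apply, repr_mul_right, map_smul]; rfl
        refine ⟨fun j hj => ?_, fun h => ?_⟩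
        · rw [Finsupp.mem_support_iff] at hj ⊢
          intro h0; apply hj; rw [hr, h0]; simp
        · have : i ∈ (B.repr y).support := by simp [hsupp, hi, ← hc]
          have := h this
          rw [Finsupp.mem_support_iff, hr, hyr, ← hc, inv_mul_cancel₀ hi] at this
          simp at this
    have := congrArg (fun z => B.repr z j) hz
    simp only [map_zero, Finsupp.zero_apply] at this
    rw [map_sub, Finsupp.sub_apply, repr_mul_right, map_smul] at this
    exact sub_eq_zero.1 this
  have hF : ∀ j, ∃ r : F, algebraMap F D r = B.repr y j := by
    intro j
    have : B.repr y j ∈ Subalgebra.center F D := by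
      rw [Subalgebra.mem_center_iff]; exact fun d => hcomm d j
    rw [Algebra.IsCentral.center_eq_bot, Algebra.mem_bot] at this
    exact this
  choose r hr using hF
  have hy : y = (1 : D) ⊗ₜ[F] (∑ j ∈ (B.repr y).support, r j • b j) := by
    conv_lhs => rw [← B.linearCombination_repr y, Finsupp.linearCombination_apply, Finsupp.sum]
    rw [TensorProduct.tmul_sum]
    refine Finset.sum_congr rfl fun j _ => ?_
    rw [← hr j, TensorProduct.tmul_smul, algebraMap_smul]
    congr 1
    simp [B]
  set k := ∑ j ∈ (B.repr y).support, r j • b j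
  have hk : k ≠ 0 := by
    intro h0
    rw [h0, TensorProduct.tmul_zero] at hy
    have := hyr i
    rw [hy, ← hc, inv_mul_cancel₀ hi] at this
    simp at this
  rw [← I.one_mem_iff]
  have := I.mul_mem_left ((1 : D) ⊗ₜ[F] k⁻¹) _ hyI
  rw [hy] at this
  rwa [Algebra.TensorProduct.tmul_mul_tmul, inv_mul_cancel₀ hk, one_mul,
    ← Algebra.TensorProduct.one_def] at this

/-- A finite-dimensional central division algebra is split by the algebraic closure. -/
theorem exists_splitting (F D : Type*) [Field F] [DivisionRing D] [Algebra F D]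
    [Algebra.IsCentral F D] [FiniteDimensional F D] :
    ∃ n : ℕ, Nonempty (AlgebraicClosure F ⊗[F] D ≃ₐ[AlgebraicClosure F]
      Matrix (Fin n) (Fin n) (AlgebraicClosure F)) := by
  have h1 := isSimpleRing_tensor F D (AlgebraicClosure F)
  have h2 : IsSimpleRing (AlgebraicClosure F ⊗[F] D) :=
    IsSimpleRing.of_ringEquiv (Algebra.TensorProduct.comm F D (AlgebraicClosure F)).toRingEquiv h1
  obtain ⟨n, _, h⟩ := IsSimpleRing.exists_algEquiv_matrix_of_isAlgClosed (AlgebraicClosure F)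
    (AlgebraicClosure F ⊗[F] D)
  exact ⟨n, h⟩

/-- The degree of `D`: the size of the matrix algebra that `D` becomes over the algebraic closure
of its centre `F`. -/
noncomputable def degree (F D : Type*) [Field F] [DivisionRing D] [Algebra F D]
    [Algebra.IsCentral F D] [FiniteDimensional F D] : ℕ :=
  (exists_splitting F D).choose

/-- A splitting isomorphism of `D` over the algebraic closure of `F`. -/
noncomputable def splitting (F D : Type*) [Field F] [DivisionRing D] [Algebra F D]
    [Algebra.IsCentral F D] [FiniteDimensional F D] :
    AlgebraicClosure F ⊗[F] D ≃ₐ[AlgebraicClosure F]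
      Matrix (Fin (degree F D)) (Fin (degree F D)) (AlgebraicClosure F) :=
  (exists_splitting F D).choose_spec.some

/-- The reduced norm `a ↦ det (φ (1 ⊗ a))`, where `φ` is a splitting isomorphism. It does not
depend on `φ`, and its values lie in `F`, which is regarded here as a subfield of its algebraic
closure. -/
noncomputable def reducedNorm (F D : Type*) [Field F] [DivisionRing D] [Algebra F D]
    [Algebra.IsCentral F D] [FiniteDimensional F D] : D →* AlgebraicClosure F where
  toFun a := (splitting F D (1 ⊗ₜ[F] a)).det
  map_one' := by rw [← Algebra.TensorProduct.one_def, map_one, Matrix.det_one]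
  map_mul' a b := by
    rw [← Matrix.det_mul, ← map_mul, Algebra.TensorProduct.tmul_mul_tmul, one_mul]

/-- The set `𝕆` of elements of `Dˣ` of reduced norm one. -/
def normOne (F D : Type*) [Field F] [DivisionRing D] [Algebra F D]
    [Algebra.IsCentral F D] [FiniteDimensional F D] : Set Dˣ :=
  {a | reducedNorm F D (a : D) = 1}

end ReducedNorm

section CommutingGraph

/-- The commuting graph of a group: the vertices are the nontrivial elements, and two distinct
vertices are joined when they commute. -/
def commutingGraph (L : Type*) [Group L] : SimpleGraph {x : L // x ≠ 1} where
  Adj x y := x ≠ y ∧ (x : L) * y = y * x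
  symm := ⟨fun _ _ h => ⟨h.1.symm, h.2.symm⟩⟩
  loopless := ⟨fun _ h => h.1 rfl⟩

/-- `x` and `y` are vertices of the commuting graph at distance greater than `k`. The distance of
two vertices that are not joined by a path is infinite. -/
def DistGT {L : Type*} [Group L] (k : ℕ∞) (x y : L) : Prop :=
  ∃ (hx : x ≠ 1) (hy : y ≠ 1), k < (commutingGraph L).edist ⟨x, hx⟩ ⟨y, hy⟩

/-- The commuting graph of `L` is balanced. -/
def IsBalanced (L : Type*) [Group L] : Prop :=
  ∃ x y : L, DistGT 3 x y ∧ DistGT 3 x (x * y) ∧ DistGT 3 y (x * y) ∧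
    DistGT 3 x (x⁻¹ * y) ∧ DistGT 3 y (x⁻¹ * y)

end CommutingGraph

section Sets

/-- `N(a) = {n ∈ N : a + n ∈ N}`. -/
def addSet {D : Type*} [DivisionRing D] (N : Subgroup Dˣ) (a : Dˣ) : Set Dˣ :=
  {n | n ∈ N ∧ ∃ m ∈ N, (m : D) = (a : D) + (n : D)}

/-- `ℙ_{x}` for `x ∈ G/N`: the elements `a` of the coset `x` with `1 ∈ N(a)`. -/
def pSet {D : Type*} [DivisionRing D] (N : Subgroup Dˣ) (x : Dˣ ⧸ N) : Set Dˣ :=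
  {a | (a : Dˣ ⧸ N) = x ∧ 1 ∈ addSet N a}

/-- `ℕ_{x}` for `x ∈ G/N`. -/
def nSet {D : Type*} [DivisionRing D] (N : Subgroup Dˣ) (x : Dˣ ⧸ N) : Set Dˣ :=
  {n | n ∈ N ∧ ∀ a ∈ pSet N x, n ∈ addSet N a}

/-- `𝕆_{x}` for `x ∈ G/N`: the elements `a` of the coset `x` with `-1 ∉ N(a) ∪ N(a⁻¹)`. -/
def oSet {D : Type*} [DivisionRing D] (N : Subgroup Dˣ) (x : Dˣ ⧸ N) : Set Dˣ :=
  {a | (a : Dˣ ⧸ N) = x ∧ -1 ∉ addSet N a ∪ addSet N a⁻¹}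

/-- `ℙ_C`, the union of the sets `ℙ_y`, for `y` in the conjugacy class `C`. -/
def pClass {D : Type*} [DivisionRing D] (N : Subgroup Dˣ) [N.Normal]
    (C : ConjClasses (Dˣ ⧸ N)) : Set Dˣ :=
  ⋃ y ∈ C.carrier, pSet N y

/-- `ℕ_C`, the intersection of the sets `ℕ_y`, for `y` in the conjugacy class `C`. -/
def nClass {D : Type*} [DivisionRing D] (N : Subgroup Dˣ) [N.Normal]
    (C : ConjClasses (Dˣ ⧸ N)) : Set Dˣ :=
  ⋂ y ∈ C.carrier, nSet N y

/-- `U_C = {n ∈ N : n, n⁻¹ ∈ ℕ_C}`. -/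
def uClass {D : Type*} [DivisionRing D] (N : Subgroup Dˣ) [N.Normal]
    (C : ConjClasses (Dˣ ⧸ N)) : Set Dˣ :=
  {n | n ∈ N ∧ n ∈ nClass N C ∧ n⁻¹ ∈ nClass N C}

/-- `𝕄_C = ℕ_C \ U_C`. -/
def mClass {D : Type*} [DivisionRing D] (N : Subgroup Dˣ) [N.Normal]
    (C : ConjClasses (Dˣ ⧸ N)) : Set Dˣ :=
  nClass N C \ uClass N C

/-- `Dˣ` satisfies the U-Hypothesis with respect to the subset `S` of `N`. -/
structure UHypothesis {D : Type*} [DivisionRing D] (N : Subgroup Dˣ) (S : Set Dˣ) : Prop where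
  nonempty : S.Nonempty
  ssubset : S ⊂ (N : Set Dˣ)
  normal : ∀ s ∈ S, ∀ g : Dˣ, g * s * g⁻¹ ∈ S
  one_mem : 1 ∈ S
  neg_one_mem : -1 ∈ S
  mul_eq : S * S = S
  add_one : ∀ n ∈ (N : Set Dˣ) \ S, ∃ s ∈ S, (s : D) = (n : D) + 1
  sub_one : ∀ n ∈ (N : Set Dˣ) \ S, ∃ m ∈ N, (m : D) = (n : D) - 1

/-- The pairs of conjugacy classes `A, B ⊆ (G/N) \ {1}` that are fixed when the diameter of the
commuting graph of `G/N` exceeds `4`. -/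
structure IsDistantPair {D : Type*} [DivisionRing D] (N : Subgroup Dˣ) [N.Normal]
    (A B : ConjClasses (Dˣ ⧸ N)) : Prop where
  left_ne_one : A ≠ ConjClasses.mk 1
  right_ne_one : B ≠ ConjClasses.mk 1
  uHypothesis : UHypothesis N (nClass N B)
  exists_distant : ∀ b ∈ pClass N B, ∃ a ∈ pClass N A,
    DistGT 4 (a : Dˣ ⧸ N) (b : Dˣ ⧸ N) ∧ addSet N a ⊆ addSet N b

/-- The conjugacy classes `C ⊆ (G/N) \ {1}` that are fixed when the commuting graph of `G/N` is
balanced. -/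
structure IsBalancedClass {D : Type*} [DivisionRing D] (N : Subgroup Dˣ) [N.Normal]
    (C : ConjClasses (Dˣ ⧸ N)) : Prop where
  ne_one : C ≠ ConjClasses.mk 1
  uHypothesis : UHypothesis N (nClass N C)
  alternative : (∃ x : Dˣ ⧸ N, x ≠ 1 ∧ oSet N x = ∅) ∨
    ∀ m ∈ mClass N C, ∃ z ∈ C.carrier, ∀ z₁ ∈ oSet N z, m ∈ addSet N z₁

/-- `K̂ = {a ∈ 𝕆U \ N : N(a) ⊇ 𝕄}`, where `U = U_X` and `𝕄 = 𝕄_X`. -/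
def kHat (F : Type*) {D : Type*} [Field F] [DivisionRing D] [Algebra F D]
    [Algebra.IsCentral F D] [FiniteDimensional F D] (N : Subgroup Dˣ) [N.Normal]
    (X : ConjClasses (Dˣ ⧸ N)) : Set Dˣ :=
  {a | a ∈ (normOne F D * uClass N X) \ (N : Set Dˣ) ∧ mClass N X ⊆ addSet N a}

end Sets

end DivQuot

/-! Write G = Dˣ. If X = Y + Z in G and one of the three lies in N, the other two commute in G/N.
Failures of membership in the sets N(a) therefore produce short paths in the commuting graph, and
large distances forbid them. For suitable cosets x, y this makes the sets N(a), N(b) nested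
(`Comparable`) and gives n - 1 ∈ N for the n that they miss (`SubOneMem`). Together these yield the
U-Hypothesis for ℕ_C, where C is the class of x or of y (`uHypothesis_of_comparable`). Properness of
ℕ_C rests on N(a) being nonempty, a Hales–Jewett argument (`addSet_nonempty`).

The rest follows from the U-Hypothesis. S preorders N totally, U is the class of 1, and elements of
N \ S are infinitesimal: adding one to an element of U stays in U. Since each n is algebraic over F,
N/U is central in G/U (`conj_mul_inv_mem`), and the transfer into the center, which has finite
index, gives v : G → Γ with n ∈ S iff v n ≥ 1 for n ∈ N (`exists_valuation`).

The core is `one_mem_addSet_of_lt_one`: v a < 1 implies a + 1 ∈ N for every a in G, although nothing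
is known about v on sums outside N. Words in the conjugates of some b ∈ ℙ_C reach every coset and
give the claim for sufficiently small v a. Commutators of congruence subgroups then extend it,
because G/N is nonabelian simple (`one_mem_addSet_of_isSmall`).

Finally, G/N is perfect, so every coset contains a product of commutators c. It has reduced norm 1
and v c = 1, while elements of 𝕄 have value above 1, so 𝕄 ⊆ N(c). The same estimate proves the
second alternative of the balanced case. -/

namespace DivQuot

/-! ### Short paths in the commuting graph. -/

section CommutingPaths

variable {L : Type*} [Group L]

theorem edist_le_one_of_commute {x y : {x : L // x ≠ 1}} (h : Commute (x : L) y) :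
    (commutingGraph L).edist x y ≤ 1 := by
  rw [SimpleGraph.edist_le_one_iff_adj_or_eq]
  by_cases hxy : x = y
  · exact Or.inr hxy
  · exact Or.inl ⟨hxy, h⟩

/-- There is no commuting chain `x, p, q, y` of nontrivial elements. -/
def Far3 (x y : L) : Prop :=
  x ≠ 1 ∧ y ≠ 1 ∧ ∀ p q : L, p ≠ 1 → q ≠ 1 → Commute x p → Commute p q → ¬ Commute q y

/-- There is no commuting chain `x, p, q, r, y` of nontrivial elements. -/
def Far4 (x y : L) : Prop :=
  x ≠ 1 ∧ y ≠ 1 ∧ ∀ p q r : L, p ≠ 1 → q ≠ 1 → r ≠ 1 → Commute x p → Commute p q →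
    Commute q r → ¬ Commute r y

theorem DistGT.far3 {x y : L} (h : DistGT 3 x y) : Far3 x y := by
  obtain ⟨hx, hy, h⟩ := h
  refine ⟨hx, hy, fun p q hp hq h1 h2 h3 => h.not_ge ?_⟩
  have e1 := edist_le_one_of_commute (x := ⟨x, hx⟩) (y := ⟨p, hp⟩) h1
  have e2 := edist_le_one_of_commute (x := ⟨p, hp⟩) (y := ⟨q, hq⟩) h2
  have e3 := edist_le_one_of_commute (x := ⟨q, hq⟩) (y := ⟨y, hy⟩) h3
  calc _ ≤ _ := SimpleGraph.edist_triangle (v := ⟨p, hp⟩)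
    _ ≤ 1 + (1 + 1) := add_le_add e1
      ((SimpleGraph.edist_triangle (v := ⟨q, hq⟩)).trans (add_le_add e2 e3))
    _ = 3 := by norm_num

theorem DistGT.far4 {x y : L} (h : DistGT 4 x y) : Far4 x y := by
  obtain ⟨hx, hy, h⟩ := h
  refine ⟨hx, hy, fun p q r hp hq hr h1 h2 h3 h4 => h.not_ge ?_⟩
  have e1 := edist_le_one_of_commute (x := ⟨x, hx⟩) (y := ⟨p, hp⟩) h1
  have e2 := edist_le_one_of_commute (x := ⟨p, hp⟩) (y := ⟨q, hq⟩) h2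
  have e3 := edist_le_one_of_commute (x := ⟨q, hq⟩) (y := ⟨r, hr⟩) h3
  have e4 := edist_le_one_of_commute (x := ⟨r, hr⟩) (y := ⟨y, hy⟩) h4
  calc _ ≤ _ := SimpleGraph.edist_triangle (v := ⟨p, hp⟩)
    _ ≤ 1 + (1 + (1 + 1)) := add_le_add e1
      ((SimpleGraph.edist_triangle (v := ⟨q, hq⟩)).trans (add_le_add e2
        ((SimpleGraph.edist_triangle (v := ⟨r, hr⟩)).trans (add_le_add e3 e4))))
    _ = 4 := by norm_num

theorem DistGT.symm {k : ℕ∞} {x y : L} (h : DistGT k x y) : DistGT k y x := by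
  obtain ⟨hx, hy, h⟩ := h
  exact ⟨hy, hx, by rwa [SimpleGraph.edist_comm]⟩

theorem DistGT.conj {k : ℕ∞} {x y : L} (h : DistGT k x y) (g : L) :
    DistGT k (g * x * g⁻¹) (g * y * g⁻¹) := by
  obtain ⟨hx, hy, h⟩ := h
  refine ⟨by simpa using hx, by simpa using hy, h.trans_le ?_⟩
  by_cases hr : (commutingGraph L).edist ⟨g * x * g⁻¹, by simpa using hx⟩
      ⟨g * y * g⁻¹, by simpa using hy⟩ = ⊤
  · rw [hr]; exact le_top
  obtain ⟨w, hw⟩ := SimpleGraph.exists_walk_of_edist_ne_top hr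
  rw [← hw]
  let f : commutingGraph L →g commutingGraph L :=
    { toFun := fun z => ⟨g⁻¹ * z.1 * g, by simpa [mul_assoc, inv_mul_eq_one] using z.2⟩
      map_rel' := by
        rintro ⟨a, ha⟩ ⟨b, hb⟩ ⟨hne, hc⟩
        refine ⟨fun hab => hne ?_, ?_⟩
        · simpa using hab
        · simp only at hc ⊢
          simp only [mul_assoc, mul_inv_cancel_left]
          rw [← mul_assoc a, hc, mul_assoc] }
  have h1 : f ⟨g * x * g⁻¹, by simpa using hx⟩ = ⟨x, hx⟩ := by ext; simp [f, mul_assoc]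
  have h2 : f ⟨g * y * g⁻¹, by simpa using hy⟩ = ⟨y, hy⟩ := by ext; simp [f, mul_assoc]
  have := SimpleGraph.edist_le ((w.map f).copy h1 h2)
  simpa using this

end CommutingPaths

/-! ### From sums in D to commuting chains in G/N. -/

section AddSet

variable {D : Type*} [DivisionRing D]

/-- After division by Z the two elements differ by 1. Every edge of the commuting graph used below
arises this way. -/
theorem commute_mul_inv_of_eq_add {X Y Z : Dˣ} (h : (X : D) = Y + Z) :
    Commute (X * Z⁻¹) (Y * Z⁻¹) := by
  have : ((X * Z⁻¹ : Dˣ) : D) = (Y * Z⁻¹ : Dˣ) + 1 := by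
    rw [Units.val_mul, h, add_mul, ← Units.val_mul, Units.mul_inv]
  refine Units.ext ?_
  rw [Units.val_mul, Units.val_mul (Y * Z⁻¹), this, add_mul, mul_add, one_mul, mul_one]

theorem eq_add_swap {X Y Z : Dˣ} (h : (X : D) = Y + Z) : (X : D) = Z + Y := by rw [h, add_comm]

variable {N : Subgroup Dˣ}

theorem mul_mem_addSet {a n k : Dˣ} (hn : n ∈ N) (hk : k ∈ addSet N a) :
    n * k ∈ addSet N (n * a) := by
  obtain ⟨hk, m, hm, h⟩ := hk
  exact ⟨N.mul_mem hn hk, n * m, N.mul_mem hn hm, by simp [h, mul_add]⟩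

theorem neg_mem_of_neg_one_mem (hneg : (-1 : Dˣ) ∈ N) {n : Dˣ} (hn : n ∈ N) : -n ∈ N := by
  rw [← neg_one_mul]; exact N.mul_mem hneg hn

theorem notMem_of_notMem_addSet {a n c : Dˣ} (hn : n ∈ N) (h : n ∉ addSet N a)
    (hc : (c : D) = a + n) : c ∉ N := fun hcN => h ⟨hn, c, hcN, hc⟩

theorem val_inv_add_inv {a n c : Dˣ} (hc : (c : D) = a + n) :
    ((a⁻¹ * c * n⁻¹ : Dˣ) : D) = (a⁻¹ : Dˣ) + (n⁻¹ : Dˣ) := by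
  rw [Units.val_mul, Units.val_mul, hc, mul_add, add_mul, ← Units.val_mul, inv_mul_cancel,
    Units.val_one, one_mul, mul_assoc, ← Units.val_mul n, mul_inv_cancel, Units.val_one, mul_one,
    add_comm]

/-- Since a⁻¹ + n⁻¹ = a⁻¹(a + n)n⁻¹, both sums lying in N would force a into N. -/
theorem inv_notMem_addSet_inv {a n : Dˣ} (ha : a ∉ N) (h : n ∈ addSet N a) :
    n⁻¹ ∉ addSet N a⁻¹ := by
  obtain ⟨hn, c, hc, h⟩ := h
  rintro ⟨-, m, hm, h'⟩
  have : m = a⁻¹ * c * n⁻¹ := Units.ext (by rw [h', val_inv_add_inv h])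
  refine ha ?_
  have ha' : a = c * n⁻¹ * m⁻¹ := by rw [this]; group
  rw [ha']
  exact N.mul_mem (N.mul_mem hc (N.inv_mem hn)) (N.inv_mem hm)

variable (N) in
/-- The sets `N(a)` and `N(b)` are comparable for all `a` in `x` and `b` in `y`. -/
def Comparable (x y : Dˣ ⧸ N) : Prop :=
  ∀ a b : Dˣ, (a : Dˣ ⧸ N) = x → (b : Dˣ ⧸ N) = y →
    addSet N a ⊆ addSet N b ∨ addSet N b ⊆ addSet N a

variable (N) in
/-- If `1` lies in `N(a)` and in `N(b)`, but `n` in neither of them, then `n - 1 ∈ N`, for all `a`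
in `x` and `b` in `y`. -/
def SubOneMem (x y : Dˣ ⧸ N) : Prop :=
  ∀ a b : Dˣ, (a : Dˣ ⧸ N) = x → (b : Dˣ ⧸ N) = y → 1 ∈ addSet N a → 1 ∈ addSet N b →
    ∀ n ∈ N, n ∉ addSet N a → n ∉ addSet N b → ∃ m ∈ N, (m : D) = n - 1

theorem Comparable.symm {x y : Dˣ ⧸ N} (h : Comparable N x y) : Comparable N y x :=
  fun a b ha hb => (h b a hb ha).symm

theorem SubOneMem.symm {x y : Dˣ ⧸ N} (h : SubOneMem N x y) : SubOneMem N y x :=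
  fun a b ha hb h1 h2 n hn h3 h4 => h b a hb ha h2 h1 n hn h4 h3

theorem mem_addSet_mul_iff {a n k : Dˣ} (hn : n ∈ N) :
    k ∈ addSet N (n * a) ↔ n⁻¹ * k ∈ addSet N a := by
  refine ⟨fun h => ?_, fun h => ?_⟩
  · simpa using mul_mem_addSet (N.inv_mem hn) h
  · simpa using mul_mem_addSet hn h

theorem neg_mem_addSet_neg (hneg : (-1 : Dˣ) ∈ N) {a n : Dˣ} (h : n ∈ addSet N a) :
    -n ∈ addSet N (-a) := by
  simpa using mul_mem_addSet hneg h

theorem exists_val_eq_add (hneg : (-1 : Dˣ) ∈ N) {a n : Dˣ} (ha : a ∉ N) (hn : n ∈ N) :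
    ∃ c : Dˣ, (c : D) = a + n := by
  refine ⟨Units.mk0 ((a : D) + n) fun h => ha ?_, rfl⟩
  have : a = -n := Units.ext (by rw [Units.val_neg]; exact eq_neg_of_add_eq_zero_left h)
  rw [this]; exact neg_mem_of_neg_one_mem hneg hn

variable [N.Normal]

theorem commute_mk_of_eq_add {X Y Z : Dˣ} (h : (X : D) = Y + Z) (hZ : Z ∈ N) :
    Commute (X : Dˣ ⧸ N) (Y : Dˣ ⧸ N) := by
  have := (commute_mul_inv_of_eq_add h).map (QuotientGroup.mk' N)
  simpa [(QuotientGroup.eq_one_iff Z).2 hZ] using this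

theorem commute_mk_of_add_eq {X Y Z : Dˣ} (h : (X : D) = Y + Z) (hX : X ∈ N) :
    Commute (Y : Dˣ ⧸ N) (Z : Dˣ ⧸ N) := by
  have := (commute_mul_inv_of_eq_add h).map (QuotientGroup.mk' N)
  simp only [map_mul, map_inv, QuotientGroup.mk'_apply, (QuotientGroup.eq_one_iff X).2 hX,
    one_mul] at this
  have h2 := Commute.inv_left_iff.1 this
  have := h2.symm.mul_left (Commute.refl _)
  simpa using this

theorem mk_ne_one {a : Dˣ} : (a : Dˣ ⧸ N) ≠ 1 ↔ a ∉ N := (QuotientGroup.eq_one_iff a).not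

theorem conj_mem_addSet {a k : Dˣ} (g : Dˣ) (hk : k ∈ addSet N a) :
    g * k * g⁻¹ ∈ addSet N (g * a * g⁻¹) := by
  obtain ⟨hk, m, hm, h⟩ := hk
  exact ⟨‹N.Normal›.conj_mem _ hk g, g * m * g⁻¹, ‹N.Normal›.conj_mem _ hm g, by
    simp [h, add_mul, mul_add]⟩

theorem conj_mem_addSet_iff {a k : Dˣ} (g : Dˣ) :
    g * k * g⁻¹ ∈ addSet N (g * a * g⁻¹) ↔ k ∈ addSet N a := by
  refine ⟨fun h => ?_, conj_mem_addSet g⟩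
  simpa [mul_assoc] using conj_mem_addSet g⁻¹ h

theorem mk_neg (hneg : (-1 : Dˣ) ∈ N) (a : Dˣ) : ((-a : Dˣ) : Dˣ ⧸ N) = a := by
  rw [← neg_one_mul, QuotientGroup.mk_mul, (QuotientGroup.eq_one_iff _).2 hneg, one_mul]

theorem inv_mem_addSet_inv_of_mk_eq {a n c : Dˣ} (hn : n ∈ N) (hc : (c : D) = a + n)
    (h : (c : Dˣ ⧸ N) = a) : n⁻¹ ∈ addSet N a⁻¹ := by
  refine ⟨N.inv_mem hn, a⁻¹ * c * n⁻¹, ?_, val_inv_add_inv hc⟩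
  rw [← QuotientGroup.eq_one_iff]
  simp [h, (QuotientGroup.eq_one_iff n).2 hn]

/-- If `s ∈ N(a)` and `-st ∉ N(ab)`, then `t⁻¹ ∈ N(b⁻¹)`, provided that `b*` is far from
`(ab)*`. -/
theorem inv_mem_addSet_inv_of_far (hneg : (-1 : Dˣ) ∈ N) {a b s t : Dˣ}
    (h : Far3 (b : Dˣ ⧸ N) (a * b : Dˣ)) (hs : s ∈ addSet N a) (ht : t ∈ N)
    (hst : -(s * t) ∉ addSet N (a * b)) : t⁻¹ ∈ addSet N b⁻¹ := by
  obtain ⟨hb, hab, hfar⟩ := h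
  obtain ⟨hsN, c, hc, hcs⟩ := hs
  have hstN : -(s * t) ∈ N := neg_mem_of_neg_one_mem hneg (N.mul_mem hsN ht)
  obtain ⟨r, hr⟩ := exists_val_eq_add hneg (mk_ne_one.1 hab) hstN
  obtain ⟨d, hd⟩ := exists_val_eq_add hneg (mk_ne_one.1 hb) ht
  have hrN : r ∉ N := notMem_of_notMem_addSet hstN hst hr
  -- The identity a(b + t) = (ab - st) + (a + s)t, with a + s in N.
  have h1 : ((a * d : Dˣ) : D) = r + (c * t : Dˣ) := by
    simp only [Units.val_mul, Units.val_neg, hd, hr, hcs]; noncomm_ring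
  have c1 : Commute ((a * d : Dˣ) : Dˣ ⧸ N) (r : Dˣ ⧸ N) :=
    commute_mk_of_eq_add h1 (N.mul_mem hc ht)
  have c2 : Commute ((a * b : Dˣ) : Dˣ ⧸ N) (r : Dˣ ⧸ N) := (commute_mk_of_eq_add hr hstN).symm
  have c3 : Commute (d : Dˣ ⧸ N) (b : Dˣ ⧸ N) := commute_mk_of_eq_add hd ht
  have c4 : Commute ((d : Dˣ ⧸ N)⁻¹ * b) (r : Dˣ ⧸ N) := by
    have := c1.inv_left.mul_left c2
    simpa [mul_assoc] using this
  refine inv_mem_addSet_inv_of_mk_eq ht hd ?_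
  by_contra hne
  -- If d and b differed modulo N, then b, d⁻¹b, r, ab would be a commuting chain; r commutes with
  -- d⁻¹b = (ad)⁻¹(ab).
  refine hfar ((d : Dˣ ⧸ N)⁻¹ * b) r ?_ (mk_ne_one.2 hrN)
    (c3.symm.inv_right.mul_right (Commute.refl _)) c4 c2.symm
  rw [Ne, inv_mul_eq_one]; exact hne

theorem exists_val_eq_sub {a b : Dˣ} (h : a ≠ b) : ∃ c : Dˣ, (c : D) = a - b :=
  ⟨Units.mk0 ((a : D) - b) fun h0 => h (Units.ext (sub_eq_zero.1 h0)), rfl⟩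

/-- Otherwise a, a + m, a - b, b + 1, b is a commuting chain modulo N: (a + m) - (a - b) = b + m and
(a - b) + (b + 1) = a + 1 lie in N. -/
theorem Far4.subset_or_subset_of_one (hneg : (-1 : Dˣ) ∈ N) {a b m : Dˣ}
    (h : Far4 (a : Dˣ ⧸ N) b) (h1 : 1 ∈ addSet N a) (h2 : 1 ∉ addSet N b)
    (h3 : m ∈ addSet N b) : m ∈ addSet N a := by
  by_contra h4
  obtain ⟨ha, hb, hfar⟩ := h
  obtain ⟨-, k, hk, hk'⟩ := h1
  obtain ⟨hm, l, hl, hl'⟩ := h3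
  obtain ⟨p, hp⟩ := exists_val_eq_add hneg (mk_ne_one.1 ha) hm
  obtain ⟨q, hq⟩ := exists_val_eq_add hneg (mk_ne_one.1 hb) N.one_mem
  have hpN := notMem_of_notMem_addSet hm h4 hp
  have hqN := notMem_of_notMem_addSet N.one_mem h2 hq
  have hab : a ≠ b := by
    rintro rfl
    exact h2 ⟨N.one_mem, k, hk, hk'⟩
  obtain ⟨c, hc⟩ := exists_val_eq_sub hab
  have hap : Commute (a : Dˣ ⧸ N) p := (commute_mk_of_eq_add hp hm).symm
  have hqb : Commute (q : Dˣ ⧸ N) b := commute_mk_of_eq_add hq N.one_mem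
  have hpc : Commute (p : Dˣ ⧸ N) c :=
    commute_mk_of_eq_add (Z := l) (by rw [hp, hc, hl']; abel) hl
  have hcq : Commute (c : Dˣ ⧸ N) q :=
    commute_mk_of_add_eq (X := k) (by rw [hk', hc, hq]; abel) hk
  by_cases hcN : c ∈ N
  · have hcom : Commute (a : Dˣ ⧸ N) b :=
      commute_mk_of_eq_add (Z := c) (by rw [hc]; abel) hcN
    exact hfar a a a ha ha ha (Commute.refl _) (Commute.refl _) (Commute.refl _) hcom
  · exact hfar p c q (mk_ne_one.2 hpN) (mk_ne_one.2 hcN) (mk_ne_one.2 hqN) hap hpc hcq hqb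

/-- Left multiplication by s⁻¹, with s in N(a) \ N(b), reduces to s = 1 and keeps both cosets. -/
theorem Far4.comparable (hneg : (-1 : Dˣ) ∈ N) {x y : Dˣ ⧸ N} (h : Far4 x y) :
    Comparable N x y := by
  rintro a b rfl rfl
  by_contra! hcon
  obtain ⟨h1, h2⟩ := hcon
  obtain ⟨s, hs, hs'⟩ := Set.not_subset.1 h1
  obtain ⟨m, hm, hm'⟩ := Set.not_subset.1 h2
  have hsN : s⁻¹ ∈ N := N.inv_mem hs.1
  have e : ∀ c : Dˣ, ((s⁻¹ * c : Dˣ) : Dˣ ⧸ N) = c := fun c => by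
    rw [QuotientGroup.mk_mul, (QuotientGroup.eq_one_iff _).2 hsN, one_mul]
  have h' : Far4 ((s⁻¹ * a : Dˣ) : Dˣ ⧸ N) (s⁻¹ * b : Dˣ) := by rwa [e, e]
  have := h'.subset_or_subset_of_one hneg (m := s⁻¹ * m) ?_ ?_ (mul_mem_addSet hsN hm)
  · rw [mem_addSet_mul_iff hsN] at this
    exact hm' (by simpa using this)
  · rw [mem_addSet_mul_iff hsN]; simpa using hs
  · rw [mem_addSet_mul_iff hsN]; simpa using hs'

/-- If `1 ∈ N(a)`, then `a + n` and `n - 1` commute modulo `N`. -/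
theorem commute_mk_sub_one {a n p w : Dˣ} (h1 : 1 ∈ addSet N a) (hp : (p : D) = a + n)
    (hw : (w : D) = n - 1) : Commute (p : Dˣ ⧸ N) w := by
  obtain ⟨-, k, hk, hk'⟩ := h1
  exact commute_mk_of_eq_add (Z := k) (by rw [hp, hw, hk', Units.val_one]; abel) hk

/-- If n - 1 were outside N, then a, a + n, n - 1, b + n, b would be a commuting chain modulo N. -/
theorem Far4.subOneMem (hneg : (-1 : Dˣ) ∈ N) {x y : Dˣ ⧸ N} (h : Far4 x y) :
    SubOneMem N x y := by
  rintro a b rfl rfl h1 h2 n hn h3 h4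
  obtain ⟨ha, hb, hfar⟩ := h
  obtain ⟨w, hw⟩ := exists_val_eq_sub (a := n) (b := 1) (by rintro rfl; exact h3 h1)
  obtain ⟨p, hp⟩ := exists_val_eq_add hneg (mk_ne_one.1 ha) hn
  obtain ⟨q, hq⟩ := exists_val_eq_add hneg (mk_ne_one.1 hb) hn
  by_contra hcon
  have hwN : w ∉ N := fun h => hcon ⟨w, h, hw⟩
  exact hfar p w q (mk_ne_one.2 (notMem_of_notMem_addSet hn h3 hp)) (mk_ne_one.2 hwN)
    (mk_ne_one.2 (notMem_of_notMem_addSet hn h4 hq)) (commute_mk_of_eq_add hp hn).symm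
    (commute_mk_sub_one h1 hp hw) (commute_mk_sub_one h2 hq hw).symm
    (commute_mk_of_eq_add hq hn)

theorem Far3.inv_left {L : Type*} [Group L] {x y : L} (h : Far3 x y) : Far3 x⁻¹ y :=
  ⟨inv_ne_one.2 h.1, h.2.1, fun p q hp hq h1 => h.2.2 p q hp hq (Commute.inv_left_iff.1 h1)⟩

theorem Far3.inv_right {L : Type*} [Group L] {x y : L} (h : Far3 x y) : Far3 x y⁻¹ :=
  ⟨h.1, inv_ne_one.2 h.2.1, fun p q hp hq h1 h2 h3 =>
    h.2.2 p q hp hq h1 h2 (Commute.inv_right_iff.1 h3)⟩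

theorem Far3.symm {L : Type*} [Group L] {x y : L} (h : Far3 x y) : Far3 y x :=
  ⟨h.2.1, h.1, fun p q hp hq h1 h2 h3 => h.2.2 q p hq hp h3.symm h2.symm h1.symm⟩

/-- Put c = a⁻¹b. Elements s of N(a) \ N(b) and t of N(b) \ N(a), used in b = ac and a = bc⁻¹, place
-1 in both N(c⁻¹) and N(c), which `inv_notMem_addSet_inv` forbids. -/
theorem comparable_of_far (hneg : (-1 : Dˣ) ∈ N) {x y : Dˣ ⧸ N} (h1 : Far3 x (x⁻¹ * y))
    (h2 : Far3 y (x⁻¹ * y)) : Comparable N x y := by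
  rintro a b rfl rfl
  by_contra! hcon
  obtain ⟨hs, ht⟩ := hcon
  obtain ⟨s, hs, hs'⟩ := Set.not_subset.1 hs
  obtain ⟨t, ht, ht'⟩ := Set.not_subset.1 ht
  have e1 : (-1 : Dˣ)⁻¹ ∈ addSet N (a⁻¹ * b)⁻¹ := by
    refine inv_mem_addSet_inv_of_far hneg (a := a) ?_ hs hneg ?_
    · simpa using h2.symm
    · simpa using hs'
  have e2 : (-1 : Dˣ)⁻¹ ∈ addSet N (a⁻¹ * b)⁻¹⁻¹ := by
    refine inv_mem_addSet_inv_of_far hneg (a := b) ?_ ht hneg ?_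
    · simpa using h1.symm.inv_left
    · simpa using ht'
  refine inv_notMem_addSet_inv (a := (a⁻¹ * b)⁻¹) ?_ e1 (by simpa using e2)
  rw [inv_mem_iff, ← mk_ne_one]
  simpa using h1.2.1

/-- If w = n - 1 were outside N, it would commute modulo N with b + n. Once it is shown to commute
with a as well, a, w, b + n, b is a forbidden chain. -/
theorem subOneMem_of_far (hneg : (-1 : Dˣ) ∈ N) {x y : Dˣ ⧸ N} (h1 : Far3 x y)
    (h2 : Far3 x (x * y)) : SubOneMem N x y := by
  rintro a b rfl rfl ha1 hb1 n hn han hbn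
  obtain ⟨ha, hb, hfar⟩ := h1
  obtain ⟨w, hw⟩ := exists_val_eq_sub (a := n) (b := 1) (by rintro rfl; exact han ha1)
  obtain ⟨p, hp⟩ := exists_val_eq_add hneg (mk_ne_one.1 ha) hn
  obtain ⟨q, hq⟩ := exists_val_eq_add hneg (mk_ne_one.1 hb) hn
  by_contra hcon
  have hwN : w ∉ N := fun h => hcon ⟨w, h, hw⟩
  have hpw := commute_mk_sub_one ha1 hp hw
  have hqw := commute_mk_sub_one hb1 hq hw
  have hi := N.inv_mem hn
  have hn1 : (n : Dˣ ⧸ N) = 1 := (QuotientGroup.eq_one_iff n).2 hn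
  have e : ∀ c : Dˣ, ((n⁻¹ * c : Dˣ) : Dˣ ⧸ N) = c := fun c => by
    rw [QuotientGroup.mk_mul, (QuotientGroup.eq_one_iff _).2 hi, one_mul]
  set α := n⁻¹ * a with hα
  set β := n⁻¹ * b with hβ
  have hβm : n⁻¹ ∈ addSet N β := by simpa using mul_mem_addSet hi hb1
  have hα1 : 1 ∉ addSet N α := by rw [mem_addSet_mul_iff hi]; simpa using han
  have hβ1 : 1 ∉ addSet N β := by rw [mem_addSet_mul_iff hi]; simpa using hbn
  -- Two uses of `inv_mem_addSet_inv_of_far`: the factorization α⁻¹ = β(αβ)⁻¹ puts -1 in N(αβ), and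
  -- then α = (αβ)β⁻¹ puts 1 in N(β).
  have hαm : n⁻¹ ∈ addSet N α⁻¹ := by
    by_contra hm
    have k1 : (-1 : Dˣ)⁻¹ ∈ addSet N (α * β)⁻¹⁻¹ := by
      refine inv_mem_addSet_inv_of_far hneg (a := β) ?_ hβm hneg ?_
      · have : β * (α * β)⁻¹ = α⁻¹ := by group
        rw [this]
        simpa [hα, hβ, hn1] using h2.symm.inv_left.inv_right
      · simpa [mul_assoc] using hm
    have k2 : (1 : Dˣ)⁻¹ ∈ addSet N β⁻¹⁻¹ := by
      refine inv_mem_addSet_inv_of_far hneg (a := α * β) (s := -1) ?_ (by simpa using k1)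
        N.one_mem ?_
      · have : α * β * β⁻¹ = α := by group
        rw [this]
        simpa [hα, hβ, hn1] using Far3.inv_left (Far3.symm ⟨ha, hb, hfar⟩)
      · simpa using hα1
    exact hβ1 (by simpa using k2)
  obtain ⟨-, l, hl, hl'⟩ := hαm
  -- Both sides equal 1 + a⁻¹n. As l lies in N, a⁻¹p commutes with w, and so does p, hence a.
  have hs' : ((a⁻¹ * p : Dˣ) : D) = (l : D) + (n⁻¹ * w : Dˣ) := by
    rw [hl', hα]
    simp only [Units.val_mul, hp, hw, Units.val_one, mul_inv_rev, inv_inv, mul_add, mul_sub, mul_one,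
      Units.inv_mul]
    abel
  have hc : Commute ((a⁻¹ * p : Dˣ) : Dˣ ⧸ N) w := by
    have := commute_mk_of_eq_add (eq_add_swap hs') hl
    rwa [e] at this
  have haw : Commute (a : Dˣ ⧸ N) w := by
    have := hpw.mul_left hc.inv_left
    simpa using this
  exact hfar w q (mk_ne_one.2 hwN) (mk_ne_one.2 (notMem_of_notMem_addSet hn hbn hq)) haw hqw.symm
    (commute_mk_of_eq_add hq hn)

end AddSet

/-! ### Finite index: every N(a) is nonempty, scalars lie in N. -/

section FiniteIndex

/-- The coefficient of the moving part of a combinatorial line is a nonempty subset sum of the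
weights, and it has to be invertible. -/
theorem exists_forall_sum_ne_zero (F : Type*) [Field F] [Infinite F] {ι : Type*} (s : Finset ι) :
    ∃ w : ι → F, ∀ t ⊆ s, t.Nonempty → ∑ i ∈ t, w i ≠ 0 := by
  classical
  induction s using Finset.induction_on with
  | empty => exact ⟨0, fun t ht hne => absurd (Finset.subset_empty.1 ht) hne.ne_empty⟩
  | insert i s hi ih =>
    obtain ⟨w, hw⟩ := ih
    obtain ⟨c, hc⟩ := Infinite.exists_notMem_finset (s.powerset.image fun t => -∑ j ∈ t, w j)
    refine ⟨Function.update w i c, fun t ht hne h0 => ?_⟩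
    have hsum : ∀ u : Finset ι, i ∉ u → ∑ j ∈ u, Function.update w i c j = ∑ j ∈ u, w j :=
      fun u hu => Finset.sum_congr rfl fun j hj =>
        Function.update_of_ne (by rintro rfl; exact hu hj) _ _
    by_cases hit : i ∈ t
    · rw [← Finset.add_sum_erase t _ hit, Function.update_self,
        hsum _ (Finset.notMem_erase i t)] at h0
      exact hc (Finset.mem_image.2 ⟨t.erase i, Finset.mem_powerset.2
        (Finset.subset_insert_iff.1 ht), (eq_neg_of_add_eq_zero_left h0).symm⟩)
    · rw [hsum t hit] at h0
      exact hw t ((Finset.subset_insert_iff_of_notMem hit).1 ht) hne h0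

variable {F D : Type*} [Field F] [DivisionRing D] [Algebra F D]

/-- If `N` has finite index and contains the nonzero scalars from an infinite central field, then
every `a` is a difference of two elements of `N`. -/
theorem addSet_nonempty [Infinite F] (N : Subgroup Dˣ) [N.Normal] [Finite (Dˣ ⧸ N)]
    (hF : ∀ f : Fˣ, Units.map (algebraMap F D).toMonoidHom f ∈ N) (a : Dˣ) :
    (addSet N a).Nonempty := by
  classical
  -- The letter `none` contributes 0, so the line contains its base point b; the letter x moves b by
  -- a scalar multiple of a representative of x times a.
  let val : Option (Dˣ ⧸ N) → D := fun o => o.elim 0 fun x => ((x.out * a : Dˣ) : D)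
  let color : D → Option (Dˣ ⧸ N) := fun d =>
    if h : d = 0 then none else some ((Units.mk0 d h : Dˣ) : Dˣ ⧸ N)
  obtain ⟨ι, _, hι⟩ := Combinatorics.Line.exists_mono_in_high_dimension
    (Option (Dˣ ⧸ N)) (Option (Dˣ ⧸ N))
  obtain ⟨w, hw⟩ := exists_forall_sum_ne_zero F (Finset.univ : Finset ι)
  obtain ⟨l, c, hl⟩ := hι fun v => color (∑ i, w i • val (v i))
  set lam : F := ∑ i with l.idxFun i = none, w i with hlam
  have hlam0 : lam ≠ 0 := by
    obtain ⟨i, hi⟩ := l.proper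
    exact hw _ (Finset.subset_univ _) ⟨i, by simp [hi]⟩
  set b : D := ∑ i, w i • val (l none i) with hb
  have hx : ∀ x, ∑ i, w i • val (l x i) = b + lam • val x := by
    intro x
    rw [hb, hlam, Finset.sum_smul, Finset.sum_filter, ← Finset.sum_add_distrib]
    refine Finset.sum_congr rfl fun i _ => ?_
    rcases h : l.idxFun i with _ | y
    · simp [h, val]
    · simp [h]
  have hl' : ∀ x, color (b + lam • val x) = c := fun x => by rw [← hx]; exact hl x
  have hval : ∀ x : Dˣ ⧸ N, val (some x) = ((x.out * a : Dˣ) : D) := fun x => rfl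
  have h0 : color b = c := by simpa [val] using hl' none
  rcases c with _ | c
  · have hb0 : b = 0 := by
      by_contra h
      simp [color, h] at h0
    have := hl' (some 1)
    rw [hb0, zero_add] at this
    by_cases h : lam • val (some (1 : Dˣ ⧸ N)) = 0
    · rw [hval, smul_eq_zero] at h
      exact absurd h (by simp [hlam0])
    · simp [color, h] at this
  · have hb0 : b ≠ 0 := by
      intro h
      simp [color, h] at h0
    -- The letter is chosen to be the color itself: b and b + λga both lie in the coset c of g, so
    -- dividing by λg on the left moves both into N.
    have h1 := hl' (some c)
    have hu0 : b + lam • val (some c) ≠ 0 := by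
      intro h
      simp [color, h] at h1
    simp only [color, hb0, dite_false, Option.some.injEq] at h0
    simp only [color, hu0, dite_false, Option.some.injEq] at h1
    set f : Dˣ := Units.map (algebraMap F D).toMonoidHom (Units.mk0 lam hlam0) with hf
    have hfv : (f : D) = algebraMap F D lam := rfl
    set g : Dˣ := c.out with hg
    have hgc : (g : Dˣ ⧸ N) = c := QuotientGroup.out_eq' c
    have hfN : (f : Dˣ ⧸ N) = 1 := (QuotientGroup.eq_one_iff f).2 (hF _)
    refine ⟨f⁻¹ * g⁻¹ * Units.mk0 b hb0, ?_, f⁻¹ * g⁻¹ * Units.mk0 _ hu0, ?_, ?_⟩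
    · rw [← QuotientGroup.eq_one_iff]
      simp [h0, hgc, hfN]
    · rw [← QuotientGroup.eq_one_iff]
      simp [h1, hgc, hfN]
    · have key : ((f⁻¹ * g⁻¹ : Dˣ) : D) * (lam • ((g * a : Dˣ) : D)) = a := by
        rw [Algebra.smul_def, ← hfv, ← Units.val_mul, ← Units.val_mul]
        congr 1
        have hcomm : Commute f g := Units.ext (by
          rw [Units.val_mul, Units.val_mul, hfv]; exact Algebra.commutes lam (g : D))
        have : f⁻¹ * g⁻¹ * (f * (g * a)) = f⁻¹ * (g⁻¹ * (f * g)) * a := by group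
        rw [this, hcomm.eq]; group
      rw [Units.val_mul, Units.val_mul _ (Units.mk0 b hb0), Units.val_mk0, Units.val_mk0, hval,
        mul_add, key, add_comm]

variable {N : Subgroup Dˣ} [N.Normal]

theorem center_quotient_eq_bot {L : Type*} [Group L] [IsSimpleGroup L]
    (hna : ∃ x y : L, x * y ≠ y * x) : Subgroup.center L = ⊥ := by
  refine (IsSimpleGroup.eq_bot_or_eq_top_of_normal _ inferInstance).resolve_right fun h => ?_
  obtain ⟨x, y, hxy⟩ := hna
  have : x ∈ Subgroup.center L := h ▸ Subgroup.mem_top x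
  exact hxy ((Subgroup.mem_center_iff.1 this y).symm)

theorem mem_of_forall_commute_mk [IsSimpleGroup (Dˣ ⧸ N)] (hna : ∃ x y : Dˣ ⧸ N, x * y ≠ y * x)
    {z : Dˣ} (h : ∀ g : Dˣ, Commute (g : Dˣ ⧸ N) z) : z ∈ N := by
  rw [← QuotientGroup.eq_one_iff, ← Subgroup.mem_bot, ← center_quotient_eq_bot hna,
    Subgroup.mem_center_iff]
  exact fun g => QuotientGroup.induction_on g h

theorem algebraMap_mem [IsSimpleGroup (Dˣ ⧸ N)] (hna : ∃ x y : Dˣ ⧸ N, x * y ≠ y * x) (f : Fˣ) :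
    Units.map (algebraMap F D).toMonoidHom f ∈ N :=
  mem_of_forall_commute_mk hna fun g =>
    (show Commute g (Units.map (algebraMap F D).toMonoidHom f) from
      Units.ext (Algebra.commutes (f : F) (g : D)).symm).map (QuotientGroup.mk' N)

theorem neg_one_mem_of_isSimpleGroup [IsSimpleGroup (Dˣ ⧸ N)]
    (hna : ∃ x y : Dˣ ⧸ N, x * y ≠ y * x) : (-1 : Dˣ) ∈ N :=
  mem_of_forall_commute_mk hna fun g =>
    (show Commute g (-1) from by rw [Commute, SemiconjBy]; simp).map (QuotientGroup.mk' N)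

theorem infinite_of_not_commute [FiniteDimensional F D] (hna : ∃ x y : Dˣ ⧸ N, x * y ≠ y * x) :
    Infinite F := by
  by_contra h
  rw [not_infinite_iff_finite] at h
  have : Finite D := Module.finite_of_finite F
  obtain ⟨x, y, hxy⟩ := hna
  induction x using QuotientGroup.induction_on
  induction y using QuotientGroup.induction_on
  rename_i x y
  refine hxy ?_
  rw [← QuotientGroup.mk_mul, ← QuotientGroup.mk_mul]
  congr 1
  exact Units.ext ((littleWedderburn D).mul_comm (x : D) (y : D))

end FiniteIndex

/-! ### The U-Hypothesis for ℕ_C. -/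

section Classes

variable {D : Type*} [DivisionRing D] {N : Subgroup Dˣ}

/-- Decides which of the two cosets supplies the class whose ℕ_C satisfies the U-Hypothesis. -/
theorem Comparable.exists_subset_or {x y : Dˣ ⧸ N} (hc : Comparable N x y) :
    (∀ b ∈ pSet N y, ∃ a ∈ pSet N x, addSet N a ⊆ addSet N b) ∨
      ∀ a ∈ pSet N x, ∃ b ∈ pSet N y, addSet N b ⊆ addSet N a := by
  by_contra! hcon
  obtain ⟨⟨b, hb, h1⟩, a, ha, h2⟩ := hcon
  rcases hc a b ha.1 hb.1 with h | h
  · exact h1 a ha h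
  · exact h2 b hb h

variable [N.Normal] {C : ConjClasses (Dˣ ⧸ N)}

theorem mem_pClass {b : Dˣ} :
    b ∈ pClass N C ↔ ConjClasses.mk (b : Dˣ ⧸ N) = C ∧ 1 ∈ addSet N b := by
  simp only [pClass, pSet, Set.mem_iUnion, Set.mem_ofPred_eq, ConjClasses.mem_carrier_iff_mk_eq]
  exact ⟨fun ⟨y, hy, h1, h2⟩ => ⟨h1 ▸ hy, h2⟩, fun ⟨h1, h2⟩ => ⟨_, h1, rfl, h2⟩⟩

theorem mem_nClass {n : Dˣ} :
    n ∈ nClass N C ↔ n ∈ N ∧ ∀ b ∈ pClass N C, n ∈ addSet N b := by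
  simp only [nClass, nSet, Set.mem_iInter, Set.mem_ofPred_eq, pClass, Set.mem_iUnion]
  refine ⟨fun h => ⟨?_, ?_⟩, fun h y hy => ⟨h.1, fun a ha => h.2 a ⟨y, hy, ha⟩⟩⟩
  · obtain ⟨y, hy⟩ := ConjClasses.exists_rep C
    exact (h y (ConjClasses.mem_carrier_iff_mk_eq.2 hy)).1
  · rintro b ⟨y, hy, hb⟩
    exact (h y hy).2 b hb

theorem conjClasses_mk_conj {L : Type*} [Group L] (g a : L) :
    ConjClasses.mk (g * a * g⁻¹) = ConjClasses.mk a :=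
  ConjClasses.mk_eq_mk_iff_isConj.2 (isConj_iff.2 ⟨g, rfl⟩).symm

theorem conj_mem_pClass {b : Dˣ} (g : Dˣ) (hb : b ∈ pClass N C) : g * b * g⁻¹ ∈ pClass N C := by
  rw [mem_pClass] at hb ⊢
  refine ⟨?_, by simpa using conj_mem_addSet g hb.2⟩
  rw [← hb.1, QuotientGroup.mk_mul, QuotientGroup.mk_mul, QuotientGroup.mk_inv,
    conjClasses_mk_conj]

theorem inv_mul_mem_pClass {b s : Dˣ} (hb : ConjClasses.mk (b : Dˣ ⧸ N) = C)
    (hs : s ∈ addSet N b) : s⁻¹ * b ∈ pClass N C := by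
  refine mem_pClass.2 ⟨?_, ?_⟩
  · rw [QuotientGroup.mk_mul, (QuotientGroup.eq_one_iff _).2 (N.inv_mem hs.1), one_mul, hb]
  · rw [mem_addSet_mul_iff (N.inv_mem hs.1)]; simpa using hs

theorem notMem_of_mem_pClass (hC : C ≠ ConjClasses.mk 1) {b : Dˣ} (hb : b ∈ pClass N C) :
    b ∉ N := by
  intro h
  rw [mem_pClass, (QuotientGroup.eq_one_iff b).2 h] at hb
  exact hC hb.1.symm

theorem one_mem_nClass : 1 ∈ nClass N C :=
  mem_nClass.2 ⟨N.one_mem, fun _ hb => (mem_pClass.1 hb).2⟩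

/-- For b ∈ ℙ_C also s⁻¹b ∈ ℙ_C, so t ∈ N(s⁻¹b), which is st ∈ N(b). -/
theorem mul_mem_nClass {s t : Dˣ} (hs : s ∈ nClass N C) (ht : t ∈ nClass N C) :
    s * t ∈ nClass N C := by
  rw [mem_nClass] at hs ht ⊢
  refine ⟨N.mul_mem hs.1 ht.1, fun b hb => ?_⟩
  have := ht.2 _ (inv_mul_mem_pClass (mem_pClass.1 hb).1 (hs.2 b hb))
  rw [mem_addSet_mul_iff (N.inv_mem hs.1)] at this
  simpa using this

theorem conj_mem_nClass {s : Dˣ} (hs : s ∈ nClass N C) (g : Dˣ) : g * s * g⁻¹ ∈ nClass N C := by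
  rw [mem_nClass] at hs ⊢
  refine ⟨‹N.Normal›.conj_mem _ hs.1 g, fun b hb => ?_⟩
  have := conj_mem_addSet g (hs.2 _ (conj_mem_pClass g⁻¹ hb))
  simpa [mul_assoc] using this

theorem exists_mk_eq (C : ConjClasses (Dˣ ⧸ N)) : ∃ b : Dˣ, ConjClasses.mk (b : Dˣ ⧸ N) = C := by
  obtain ⟨y, rfl⟩ := ConjClasses.exists_rep C
  obtain ⟨b, rfl⟩ := QuotientGroup.mk_surjective y
  exact ⟨b, rfl⟩

/-- For b' ∈ ℙ_C and k ∈ N(b'⁻¹), the element k⁻¹ of N is missing from N(b'). -/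
theorem nClass_ssubset (hne : ∀ a : Dˣ, (addSet N a).Nonempty) (hC : C ≠ ConjClasses.mk 1) :
    nClass N C ⊂ (N : Set Dˣ) := by
  refine ⟨fun n hn => (mem_nClass.1 hn).1, fun h => ?_⟩
  obtain ⟨b, hb⟩ := exists_mk_eq C
  obtain ⟨n, hn⟩ := hne b
  have hb' := inv_mul_mem_pClass hb hn
  obtain ⟨k, hk⟩ := hne (n⁻¹ * b)⁻¹
  have h1 := inv_notMem_addSet_inv (N.inv_mem_iff.not.2 (notMem_of_mem_pClass hC hb')) hk
  rw [inv_inv] at h1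
  exact h1 ((mem_nClass.1 (h (N.inv_mem hk.1))).2 _ hb')

theorem uHypothesis_nClass (hneg : (-1 : Dˣ) ∈ N) (hne : ∀ a : Dˣ, (addSet N a).Nonempty)
    (hC : C ≠ ConjClasses.mk 1) (h1 : ∀ b ∈ pClass N C, -1 ∈ addSet N b)
    (h2 : ∀ n ∈ N, n ∉ nClass N C → ∃ m ∈ N, (m : D) = n - 1) :
    UHypothesis N (nClass N C) := by
  have hneg1 : -1 ∈ nClass N C := mem_nClass.2 ⟨hneg, h1⟩
  have hnegS : ∀ n, n ∉ nClass N C → -n ∉ nClass N C := fun n hn h =>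
    hn (by simpa using mul_mem_nClass hneg1 h)
  have hadd : ∀ n ∈ N, n ∉ nClass N C → ∃ m ∈ N, (m : D) = n + 1 := by
    intro n hn hnS
    obtain ⟨m, hm, hm'⟩ := h2 (-n) (neg_mem_of_neg_one_mem hneg hn) (hnegS n hnS)
    exact ⟨-m, neg_mem_of_neg_one_mem hneg hm, by simp [hm', add_comm]⟩
  refine ⟨⟨1, one_mem_nClass⟩, nClass_ssubset hne hC, fun s hs g => conj_mem_nClass hs g,
    one_mem_nClass, hneg1, ?_, ?_, fun n hn => h2 n hn.1 hn.2⟩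
  · refine Set.Subset.antisymm ?_ fun s hs => Set.mem_mul.2 ⟨s, hs, 1, one_mem_nClass, mul_one s⟩
    rintro _ ⟨s, hs, t, ht, rfl⟩
    exact mul_mem_nClass hs ht
  · rintro n ⟨hn, hnS⟩
    obtain ⟨m, hm, hm'⟩ := hadd n hn hnS
    refine ⟨m, mem_nClass.2 ⟨hm, fun b hb => ?_⟩, hm'⟩
    by_contra hmb
    obtain ⟨-, k, hk, hk'⟩ := (mem_pClass.1 hb).2
    -- Otherwise k⁻¹n + 1 ∈ N, and b + m = k + n = k(k⁻¹n + 1) would put m in N(b).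
    have hr : k⁻¹ * n ∈ nClass N C := by
      by_contra hr
      obtain ⟨l, hl, hl'⟩ := hadd _ (N.mul_mem (N.inv_mem hk) hn) hr
      refine hmb ⟨hm, k * l, N.mul_mem hk hl, ?_⟩
      rw [Units.val_mul, hl', mul_add, ← Units.val_mul, mul_inv_cancel_left, mul_one, hk', hm',
        Units.val_one]
      abel
    -- So k - 1 lies in N; but k - 1 = b.
    have hkS : k ∉ nClass N C := fun h => hnS (by simpa using mul_mem_nClass h hr)
    obtain ⟨l, hl, hl'⟩ := h2 k hk hkS
    refine notMem_of_mem_pClass hC hb ?_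
    have : b = l := Units.ext (by rw [hl', hk', Units.val_one]; abel)
    rwa [this]

theorem mk_ne_mk_one {L : Type*} [Group L] {y : L} (hy : y ≠ 1) :
    ConjClasses.mk y ≠ ConjClasses.mk 1 := by
  rw [Ne, ConjClasses.mk_eq_mk_iff_isConj, isConj_one_left.eq]
  exact hy

theorem exists_conj_mem_pSet {y : Dˣ ⧸ N} {b : Dˣ} (hb : b ∈ pClass N (ConjClasses.mk y)) :
    ∃ g : Dˣ, g * b * g⁻¹ ∈ pSet N y := by
  rw [mem_pClass, ConjClasses.mk_eq_mk_iff_isConj, isConj_iff] at hb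
  obtain ⟨⟨g, hg⟩, hb⟩ := hb
  obtain ⟨g, rfl⟩ := QuotientGroup.mk_surjective g
  exact ⟨g, by simpa using hg, by simpa using conj_mem_addSet g hb⟩

theorem uHypothesis_of_comparable (hneg : (-1 : Dˣ) ∈ N) (hne : ∀ a : Dˣ, (addSet N a).Nonempty)
    {x y : Dˣ ⧸ N} (hy : y ≠ 1) (hc : Comparable N x y) (hs : SubOneMem N x y)
    (h : ∀ b ∈ pSet N y, ∃ a ∈ pSet N x, addSet N a ⊆ addSet N b) :
    UHypothesis N (nClass N (ConjClasses.mk y)) := by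
  refine uHypothesis_nClass hneg hne (mk_ne_mk_one hy) (fun b hb => ?_) fun n hn hnS => ?_
  · obtain ⟨g, hg⟩ := exists_conj_mem_pSet hb
    rw [← conj_mem_addSet_iff g]
    simp only [mul_neg, mul_one, neg_mul, mul_inv_cancel]
    obtain ⟨a, ha, hab⟩ := h _ hg
    set b' := g * b * g⁻¹
    by_contra hcon
    -- Compare N(a) with N(-b'): either 1 ∈ N(a) ⊆ N(-b'), or -1 ∈ N(-b') ⊆ N(a) ⊆ N(b').
    rcases hc a (-b') ha.1 (by rw [mk_neg hneg, hg.1]) with h3 | h3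
    · have := neg_mem_addSet_neg hneg (h3 ha.2)
      exact hcon (by simpa using this)
    · exact hcon (hab (h3 (neg_mem_addSet_neg hneg hg.2)))
  · rw [mem_nClass] at hnS
    push Not at hnS
    obtain ⟨b, hb, hnb⟩ := hnS hn
    obtain ⟨g, hg⟩ := exists_conj_mem_pSet hb
    obtain ⟨a, ha, hab⟩ := h _ hg
    rw [← conj_mem_addSet_iff g] at hnb
    obtain ⟨m, hm, hm'⟩ := hs a _ ha.1 hg.1 ha.2 hg.2 _ (‹N.Normal›.conj_mem _ hn g)
      (fun h => hnb (hab h)) hnb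
    refine ⟨g⁻¹ * m * g, ?_, ?_⟩
    · simpa using ‹N.Normal›.conj_mem _ hm g⁻¹
    · simp [hm', mul_sub, sub_mul, mul_assoc]

end Classes

-- The quotient is perfect. Each coset thus has a representative killed by every homomorphism to an
-- abelian group, in particular by the reduced norm and by v.
open scoped commutatorElement in
theorem exists_commutator_mk_eq {G : Type*} [Group G] {N : Subgroup G} [N.Normal]
    [IsSimpleGroup (G ⧸ N)] (hna : ∃ x y : G ⧸ N, x * y ≠ y * x) (x : G ⧸ N) :
    ∃ c ∈ commutator G, (c : G ⧸ N) = x := by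
  have hn : ((commutator G).map (QuotientGroup.mk' N)).Normal :=
    Subgroup.Normal.map inferInstance _ (QuotientGroup.mk'_surjective N)
  rcases IsSimpleGroup.eq_bot_or_eq_top_of_normal _ hn with h | h
  · obtain ⟨x, y, hxy⟩ := hna
    obtain ⟨a, rfl⟩ := QuotientGroup.mk_surjective x
    obtain ⟨b, rfl⟩ := QuotientGroup.mk_surjective y
    have hab : QuotientGroup.mk' N ⁅a, b⁆ ∈ (commutator G).map (QuotientGroup.mk' N) :=
      Subgroup.mem_map_of_mem _
        (Subgroup.commutator_mem_commutator (Subgroup.mem_top a) (Subgroup.mem_top b))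
    rw [h, Subgroup.mem_bot, map_commutatorElement, commutatorElement_eq_one_iff_mul_comm] at hab
    exact absurd hab hxy
  · have hx : x ∈ (commutator G).map (QuotientGroup.mk' N) := h ▸ Subgroup.mem_top x
    obtain ⟨c, hc, hcx⟩ := hx
    exact ⟨c, hc, hcx⟩

/-! ### The preorder on N and the additive group of infinitesimals. -/

namespace UHypothesis

variable {D : Type*} [DivisionRing D] {N : Subgroup Dˣ} {S : Set Dˣ}

theorem mem_group (h : UHypothesis N S) {s : Dˣ} (hs : s ∈ S) : s ∈ N := h.ssubset.1 hs

theorem mul_mem (h : UHypothesis N S) {s t : Dˣ} (hs : s ∈ S) (ht : t ∈ S) : s * t ∈ S := by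
  rw [← h.mul_eq]; exact Set.mul_mem_mul hs ht

theorem neg_mem (h : UHypothesis N S) {s : Dˣ} (hs : s ∈ S) : -s ∈ S := by
  simpa using h.mul_mem h.neg_one_mem hs

theorem neg_notMem (h : UHypothesis N S) {s : Dˣ} (hs : s ∉ S) : -s ∉ S := fun h' =>
  hs (by simpa using h.neg_mem h')

/-- The group of all `u` with `u, u⁻¹ ∈ S`. -/
def unitGroup (h : UHypothesis N S) : Subgroup Dˣ where
  carrier := {u | u ∈ S ∧ u⁻¹ ∈ S}
  mul_mem' ha hb := ⟨h.mul_mem ha.1 hb.1, by rw [mul_inv_rev]; exact h.mul_mem hb.2 ha.2⟩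
  one_mem' := ⟨h.one_mem, by simpa using h.one_mem⟩
  inv_mem' ha := ⟨ha.2, by simpa using ha.1⟩

theorem mem_unitGroup (h : UHypothesis N S) {u : Dˣ} : u ∈ h.unitGroup ↔ u ∈ S ∧ u⁻¹ ∈ S :=
  Iff.rfl

instance (h : UHypothesis N S) : h.unitGroup.Normal :=
  ⟨fun u hu g => ⟨h.normal u hu.1 g, by simpa [mul_assoc] using h.normal _ hu.2 g⟩⟩

theorem neg_mem_unitGroup (h : UHypothesis N S) {u : Dˣ} (hu : u ∈ h.unitGroup) :
    -u ∈ h.unitGroup := ⟨h.neg_mem hu.1, by rw [inv_neg]; exact h.neg_mem hu.2⟩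

theorem mul_notMem (h : UHypothesis N S) {n t : Dˣ} (hn : n ∉ S) (ht : t⁻¹ ∈ S) : n * t ∉ S :=
  fun h' => hn (by simpa using h.mul_mem h' ht)

theorem mul_notMem' (h : UHypothesis N S) {n t : Dˣ} (hn : n ∉ S) (ht : t⁻¹ ∈ S) : t * n ∉ S :=
  fun h' => hn (by simpa using h.mul_mem ht h')

theorem conj_notMem (h : UHypothesis N S) {n : Dˣ} (hn : n ∉ S) (g : Dˣ) : g * n * g⁻¹ ∉ S :=
  fun h' => hn (by simpa [mul_assoc] using h.normal _ h' g⁻¹)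

theorem exists_unit_eq_add_one (h : UHypothesis N S) {n : Dˣ} (hn : n ∈ N) (hnS : n ∉ S) :
    ∃ u ∈ h.unitGroup, (u : D) = n + 1 := by
  obtain ⟨u, hu, hu'⟩ := h.add_one n ⟨hn, hnS⟩
  refine ⟨u, ⟨hu, ?_⟩, hu'⟩
  by_contra hk
  have hkN : u⁻¹ ∈ N := N.inv_mem (h.mem_group hu)
  have hkN' : -u⁻¹ ∈ N := by
    rw [← neg_one_mul]; exact N.mul_mem (h.mem_group h.neg_one_mem) hkN
  -- Here s = 1 - u⁻¹, so us = u - 1 = n would lie in S.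
  obtain ⟨s, hs, hs'⟩ := h.add_one _ ⟨hkN', h.neg_notMem hk⟩
  refine hnS ?_
  have : n = u * s := Units.ext (by
    rw [Units.val_mul, hs', Units.val_neg, mul_add, mul_neg, Units.mul_inv, hu', mul_one]; abel)
  rw [this]
  exact h.mul_mem hu hs

/-- Totality of the preorder: if n and n⁻¹ were both outside S, then n + 1 and n⁻¹ + 1 would be
units of S with quotient n. -/
theorem inv_mem_of_notMem (h : UHypothesis N S) {n : Dˣ} (hn : n ∈ N) (hnS : n ∉ S) :
    n⁻¹ ∈ S := by
  by_contra hk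
  obtain ⟨u, hu, hu'⟩ := h.exists_unit_eq_add_one hn hnS
  obtain ⟨w, hw, hw'⟩ := h.exists_unit_eq_add_one (N.inv_mem hn) hk
  refine hnS ?_
  have : n = u * w⁻¹ := by
    rw [eq_mul_inv_iff_mul_eq]
    exact Units.ext (by rw [Units.val_mul, hw', mul_add, Units.mul_inv, hu']; rw [mul_one, add_comm])
  rw [this]
  exact (h.unitGroup.mul_mem hu (h.unitGroup.inv_mem hw)).1

theorem mul_notMem_of_notMem (h : UHypothesis N S) {n t : Dˣ} (hn : n ∉ S) (ht : t ∈ N)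
    (htS : t ∉ S) : n * t ∉ S := h.mul_notMem hn (h.inv_mem_of_notMem ht htS)

theorem pow_notMem (h : UHypothesis N S) {n : Dˣ} (hn : n ∈ N) (hnS : n ∉ S) {k : ℕ}
    (hk : k ≠ 0) : n ^ k ∉ S := by
  induction k with
  | zero => exact absurd rfl hk
  | succ k ih =>
    rcases eq_or_ne k 0 with rfl | hk0
    · simpa using hnS
    · rw [pow_succ]; exact h.mul_notMem_of_notMem (ih hk0) hn hnS

/-- The additive group generated by `N \ S`. -/
def ideal (_ : UHypothesis N S) : AddSubgroup D :=
  AddSubgroup.closure {d | ∃ n ∈ N, n ∉ S ∧ (n : D) = d}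

theorem mem_ideal (h : UHypothesis N S) {n : Dˣ} (hn : n ∈ N) (hnS : n ∉ S) :
    (n : D) ∈ h.ideal := AddSubgroup.subset_closure ⟨n, hn, hnS, rfl⟩

/-- For a generator n, u + n = u(1 + u⁻¹n) with u⁻¹n still in N \ S. Hence the ideal is proper, and
1 + p ∈ N for every p in it. -/
theorem exists_unit_eq_add (h : UHypothesis N S) {p : D} (hp : p ∈ h.ideal) :
    ∀ u ∈ h.unitGroup, ∃ w ∈ h.unitGroup, (w : D) = u + p := by
  induction hp using AddSubgroup.closure_induction with
  | mem p hp =>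
    obtain ⟨n, hn, hnS, rfl⟩ := hp
    intro u hu
    obtain ⟨w, hw, hw'⟩ := h.exists_unit_eq_add_one (n := u⁻¹ * n)
      (N.mul_mem (h.mem_group hu.2) hn) (h.mul_notMem' hnS (by simpa using hu.1))
    refine ⟨u * w, h.unitGroup.mul_mem hu hw, ?_⟩
    rw [Units.val_mul, hw', mul_add, ← Units.val_mul, mul_inv_cancel_left, mul_one, add_comm]
  | zero => exact fun u hu => ⟨u, hu, by simp⟩
  | add p q _ _ ihp ihq =>
    intro u hu
    obtain ⟨w, hw, hw'⟩ := ihp u hu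
    obtain ⟨z, hz, hz'⟩ := ihq w hw
    exact ⟨z, hz, by rw [hz', hw', add_assoc]⟩
  | neg p _ ih =>
    intro u hu
    obtain ⟨w, hw, hw'⟩ := ih (-u) (h.neg_mem_unitGroup hu)
    exact ⟨-w, h.neg_mem_unitGroup hw, by rw [Units.val_neg, hw', Units.val_neg]; abel⟩

theorem one_notMem_ideal (h : UHypothesis N S) : (1 : D) ∉ h.ideal := by
  intro h1
  obtain ⟨w, -, hw⟩ := h.exists_unit_eq_add h1 (-1) (h.neg_mem_unitGroup h.unitGroup.one_mem)
  exact w.ne_zero (by rw [hw]; simp)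

/-! ### N is central modulo U. -/

section Central

variable {F : Type*} [Field F] [Algebra F D] [FiniteDimensional F D]

local notation "φ" => Units.map (RingHom.toMonoidHom (algebraMap F D))

/-- If no scalar multiple of a positive power of n were in U, the terms of the minimal polynomial of
n would have pairwise different classes modulo U. Their sum would then be a unit of U times one
dominant term, hence nonzero. -/
theorem exists_pow_mem (h : UHypothesis N S) (hF : ∀ f : Fˣ, φ f ∈ N) {n : Dˣ} (hn : n ∈ N) :
    ∃ k ≠ 0, ∃ f : Fˣ, φ f * n ^ k ∈ h.unitGroup := by
  classical
  by_contra! hcon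
  have hlt : ∀ i j : ℕ, i < j → ∀ f g : Fˣ, φ f * n ^ j * (φ g * n ^ i)⁻¹ ∉ h.unitGroup := by
    intro i j hij f g hmem
    refine hcon (j - i) (by omega) (g⁻¹ * f) ?_
    have hc : ∀ z : Dˣ, Commute (φ g⁻¹) z := fun z =>
      Units.ext (Algebra.commutes ((g⁻¹ : Fˣ) : F) (z : D))
    have : φ (g⁻¹ * f) * n ^ (j - i) = φ f * n ^ j * (φ g * n ^ i)⁻¹ := by
      rw [map_mul, (hc (φ f)).eq, mul_inv_rev, ← map_inv, mul_assoc, mul_assoc,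
        (hc (n ^ (j - i))).eq, pow_sub n hij.le, mul_assoc]
    rwa [this]
  have key : ∀ (c : ℕ → Fˣ) (s : Finset ℕ), s.Nonempty →
      ∃ i ∈ s, ∃ u ∈ h.unitGroup,
        ∑ j ∈ s, ((φ (c j) * n ^ j : Dˣ) : D) = ((u * (φ (c i) * n ^ i) : Dˣ) : D) := by
    intro c s hs
    induction hs using Finset.Nonempty.cons_induction with
    | singleton i => exact ⟨i, by simp, 1, h.unitGroup.one_mem, by simp⟩
    | cons j s hj hs ih =>
      obtain ⟨i, hi, u, hu, hsum⟩ := ih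
      have hji : j ≠ i := fun e => hj (e ▸ hi)
      have hN : ∀ i, φ (c i) * n ^ i ∈ N := fun i => N.mul_mem (hF _) (N.pow_mem hn _)
      set t := φ (c j) * n ^ j with ht
      set r := u * (φ (c i) * n ^ i) with hr
      have hrN : t * r⁻¹ ∈ N := N.mul_mem (hN j) (N.inv_mem (N.mul_mem (h.mem_group hu.1) (hN i)))
      have hU : t * r⁻¹ ∉ h.unitGroup := by
        intro hmem
        have h1 : t * (φ (c i) * n ^ i)⁻¹ ∈ h.unitGroup := by
          have := h.unitGroup.mul_mem hmem hu
          rwa [hr, mul_inv_rev, ← mul_assoc, inv_mul_cancel_right] at this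
        rcases lt_or_gt_of_ne hji with hlt' | hlt'
        · refine hlt _ _ hlt' (c i) (c j) ?_
          have := h.unitGroup.inv_mem h1
          rwa [mul_inv_rev, inv_inv] at this
        · exact hlt _ _ hlt' _ _ h1
      rw [Finset.sum_cons, hsum]
      -- The new term t and the partial sum r are inequivalent, so one is infinitesimal relative to
      -- the other and the dominant one is factored out.
      by_cases hS : t * r⁻¹ ∈ S
      · have hS' : r * t⁻¹ ∉ S := fun h' => hU ⟨hS, by rwa [mul_inv_rev, inv_inv]⟩
        obtain ⟨w, hw, hw'⟩ := h.exists_unit_eq_add_one (n := r * t⁻¹)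
          (by have := N.inv_mem hrN; rwa [mul_inv_rev, inv_inv] at this) hS'
        refine ⟨j, Finset.mem_cons_self j s, w, hw, ?_⟩
        change (t : D) + r = _
        rw [Units.val_mul w, hw', add_mul, ← Units.val_mul, inv_mul_cancel_right, one_mul, add_comm]
      · obtain ⟨w, hw, hw'⟩ := h.exists_unit_eq_add_one hrN hS
        refine ⟨i, Finset.mem_cons_of_mem hi, w * u, h.unitGroup.mul_mem hw hu, ?_⟩
        change (t : D) + r = _
        rw [mul_assoc, ← hr, Units.val_mul w, hw', add_mul, ← Units.val_mul, inv_mul_cancel_right,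
          one_mul]
  set p := minpoly F (n : D) with hp
  have hp0 : p ≠ 0 := minpoly.ne_zero (Algebra.IsIntegral.isIntegral (n : D))
  have h0 : Polynomial.aeval (n : D) p = 0 := minpoly.aeval F (n : D)
  let c : ℕ → Fˣ := fun i => if hi : p.coeff i = 0 then 1 else Units.mk0 _ hi
  obtain ⟨i, -, u, -, hsum⟩ := key c p.support (Polynomial.support_nonempty.2 hp0)
  rw [Polynomial.aeval_def, Polynomial.eval₂_eq_sum, Polynomial.sum_def] at h0
  have : ∑ j ∈ p.support, ((φ (c j) * n ^ j : Dˣ) : D) = 0 := by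
    rw [← h0]
    refine Finset.sum_congr rfl fun j hj => ?_
    have hcj : ((c j : Fˣ) : F) = p.coeff j := by
      simp [c, Polynomial.mem_support_iff.1 hj]
    rw [Units.val_mul, Units.val_pow_eq_pow_val, Units.coe_map, hcj]
    rfl
  rw [this] at hsum
  exact (u * (φ (c i) * n ^ i)).ne_zero hsum.symm

theorem pow_mul_inv_pow_notMem (h : UHypothesis N S) {a b : Dˣ} (ha : a ∈ N) (hb : b ∈ N)
    (hab : a * b⁻¹ ∉ S) {k : ℕ} (hk : k ≠ 0) : a ^ k * (b ^ k)⁻¹ ∉ S := by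
  induction k with
  | zero => exact absurd rfl hk
  | succ k ih =>
    rcases eq_or_ne k 0 with rfl | hk0
    · simpa using hab
    · have e : a ^ (k + 1) * (b ^ (k + 1))⁻¹ = a * (a ^ k * (b ^ k)⁻¹) * a⁻¹ * (a * b⁻¹) := by
        rw [pow_succ' a, pow_succ b]; group
      rw [e]
      exact h.mul_notMem_of_notMem (h.conj_notMem (ih hk0) a) (N.mul_mem ha (N.inv_mem hb)) hab

variable [N.Normal]

/-- The claim holds for a power of n, since that power is a scalar modulo U.
`pow_mul_inv_pow_notMem` transfers it to n, as strict inequalities survive powers. -/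
theorem conj_mul_inv_mem (h : UHypothesis N S) (hF : ∀ f : Fˣ, φ f ∈ N) {n : Dˣ} (hn : n ∈ N)
    (g : Dˣ) : g * n * g⁻¹ * n⁻¹ ∈ h.unitGroup := by
  obtain ⟨k, hk, f, hf⟩ := h.exists_pow_mem hF hn
  have hgn := ‹N.Normal›.conj_mem _ hn g
  have hc : ∀ z : Dˣ, Commute (φ f) z := fun z =>
    Units.ext (Algebra.commutes (f : F) (z : D))
  have hpow : (g * n * g⁻¹) ^ k * (n ^ k)⁻¹ ∈ h.unitGroup := by
    have h1 := h.unitGroup.mul_mem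
      ((inferInstance : h.unitGroup.Normal).conj_mem _ hf g) (h.unitGroup.inv_mem hf)
    have e : g * (φ f * n ^ k) * g⁻¹ * (φ f * n ^ k)⁻¹ = (g * n * g⁻¹) ^ k * (n ^ k)⁻¹ := by
      rw [conj_pow, ← mul_assoc g, ← (hc g).eq, (hc (n ^ k)).eq, mul_inv_rev, mul_assoc (φ f) g,
        mul_assoc (φ f), (hc _).eq]
      group
    rwa [e] at h1
  refine ⟨?_, ?_⟩
  · by_contra hS
    exact h.pow_mul_inv_pow_notMem hgn hn hS hk hpow.1
  · by_contra hS
    rw [mul_inv_rev, inv_inv] at hS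
    refine h.pow_mul_inv_pow_notMem hn hgn hS hk ?_
    simpa using hpow.2

end Central

/-! ### The homomorphism to an ordered abelian group. -/

open scoped IsMulCommutative

universe u

variable {D : Type u} [DivisionRing D] {N : Subgroup Dˣ} {S : Set Dˣ}

/-- The positive cone that `S` defines on the center of `Dˣ` modulo the group of units of `S`. -/
def cone (h : UHypothesis N S) : GroupCone (Subgroup.center (Dˣ ⧸ h.unitGroup)) where
  carrier := {c | ∃ s ∈ S, (s : Dˣ ⧸ h.unitGroup) = c}
  mul_mem' := by
    rintro a b ⟨s, hs, hsa⟩ ⟨t, ht, htb⟩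
    exact ⟨s * t, h.mul_mem hs ht, by rw [QuotientGroup.mk_mul, hsa, htb]; rfl⟩
  one_mem' := ⟨1, h.one_mem, rfl⟩
  eq_one_of_mem_of_inv_mem' := by
    rintro a ⟨s, hs, hsa⟩ ⟨t, ht, hta⟩
    have hst : s * t ∈ h.unitGroup := by
      rw [← QuotientGroup.eq_one_iff, QuotientGroup.mk_mul, hsa, hta]; simp
    have : s ∈ h.unitGroup := by
      refine ⟨hs, ?_⟩
      have : s⁻¹ = t * (s * t)⁻¹ := by group
      rw [this]
      exact h.mul_mem ht hst.2
    exact Subtype.ext (by rw [← hsa, (QuotientGroup.eq_one_iff s).2 this]; rfl)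

theorem mk_mem_cone (h : UHypothesis N S) {g : Dˣ} {c : Subgroup.center (Dˣ ⧸ h.unitGroup)}
    (hg : (g : Dˣ ⧸ h.unitGroup) = c) : c ∈ h.cone ↔ g ∈ S := by
  refine ⟨fun ⟨s, hs, hsc⟩ => ?_, fun hgS => ⟨g, hgS, hg⟩⟩
  have : s⁻¹ * g ∈ h.unitGroup := QuotientGroup.eq.1 (hsc.trans hg.symm)
  simpa using h.mul_mem hs this.1

variable [N.Normal]

/-- The center of G/N is trivial. Consequently S orders the whole center of G/U totally. -/
theorem mem_of_mk_mem_center [IsSimpleGroup (Dˣ ⧸ N)] (hna : ∃ x y : Dˣ ⧸ N, x * y ≠ y * x)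
    (h : UHypothesis N S) {g : Dˣ} (hg : (g : Dˣ ⧸ h.unitGroup) ∈ Subgroup.center _) : g ∈ N := by
  refine mem_of_forall_commute_mk hna fun z => ?_
  have h1 := Subgroup.mem_center_iff.1 hg z
  rw [← QuotientGroup.mk_mul, ← QuotientGroup.mk_mul, QuotientGroup.eq] at h1
  have h2 : ((z * g : Dˣ) : Dˣ ⧸ N) = (g * z : Dˣ) := QuotientGroup.eq.2 (h.mem_group h1.1)
  exact h2

open Classical in
/-- The total preorder of `N` given by `S` comes from a homomorphism of `Dˣ` to a totally ordered
abelian group. -/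
theorem exists_valuation {F : Type*} [Field F] [Algebra F D] [FiniteDimensional F D]
    [Finite (Dˣ ⧸ N)] [IsSimpleGroup (Dˣ ⧸ N)] (hna : ∃ x y : Dˣ ⧸ N, x * y ≠ y * x)
    (h : UHypothesis N S) :
    ∃ (Γ : Type u) (_ : CommGroup Γ) (_ : LinearOrder Γ) (_ : IsOrderedMonoid Γ) (v : Dˣ →* Γ),
      ∀ n ∈ N, 1 ≤ v n ↔ n ∈ S := by
  have hle : N.map (QuotientGroup.mk' h.unitGroup) ≤ Subgroup.center (Dˣ ⧸ h.unitGroup) := by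
    rintro _ ⟨n, hn, rfl⟩
    rw [Subgroup.mem_center_iff]
    intro x
    obtain ⟨g, rfl⟩ := QuotientGroup.mk_surjective x
    have h1 := h.conj_mul_inv_mem (fun f => algebraMap_mem (F := F) hna f) hn g
    rw [← QuotientGroup.eq_one_iff] at h1
    simpa [mul_inv_eq_one, mul_inv_eq_iff_eq_mul] using h1
  have hfin : (Subgroup.center (Dˣ ⧸ h.unitGroup)).FiniteIndex := by
    have : N.FiniteIndex := Subgroup.finiteIndex_of_finite_quotient
    have : (N.map (QuotientGroup.mk' h.unitGroup)).FiniteIndex :=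
      ⟨fun h0 => Subgroup.FiniteIndex.index_ne_zero (H := N) (Nat.eq_zero_of_zero_dvd
        (h0 ▸ Subgroup.index_map_dvd N (QuotientGroup.mk'_surjective _)))⟩
    exact Subgroup.finiteIndex_of_le hle
  have hrep : ∀ c : Subgroup.center (Dˣ ⧸ h.unitGroup), ∃ g ∈ N,
      (g : Dˣ ⧸ h.unitGroup) = c := fun c => by
    obtain ⟨g, hg⟩ := QuotientGroup.mk_surjective (c : Dˣ ⧸ h.unitGroup)
    exact ⟨g, h.mem_of_mk_mem_center hna (hg ▸ c.2), hg⟩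
  have hmem : HasMemOrInvMem h.cone := by
    refine ⟨fun c => ?_⟩
    obtain ⟨g, hg, hgc⟩ := hrep c
    by_cases hgS : g ∈ S
    · exact Or.inl ((h.mk_mem_cone hgc).2 hgS)
    · exact Or.inr ((h.mk_mem_cone (g := g⁻¹) (by rw [QuotientGroup.mk_inv, hgc]; rfl)).2
        (h.inv_mem_of_notMem hg hgS))
  -- The transfer into the center is raising to the power of its index, so v n is a positive power
  -- of the class of n and has the same sign.
  refine ⟨Subgroup.center (Dˣ ⧸ h.unitGroup), inferInstance, LinearOrder.mkOfGroupCone h.cone,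
    IsOrderedMonoid.mkOfCone h.cone,
    (MonoidHom.transferCenterPow _).comp (QuotientGroup.mk' h.unitGroup), fun n hn => ?_⟩
  have hv : ((n ^ (Subgroup.center (Dˣ ⧸ h.unitGroup)).index : Dˣ) : Dˣ ⧸ h.unitGroup) =
      (MonoidHom.transferCenterPow _) (n : Dˣ ⧸ h.unitGroup) := rfl
  have h0 : (Subgroup.center (Dˣ ⧸ h.unitGroup)).index ≠ 0 := hfin.index_ne_zero
  change _ / 1 ∈ h.cone ↔ _
  rw [div_one]
  refine (h.mk_mem_cone hv).trans ⟨fun hp => ?_, fun hS => ?_⟩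
  · by_contra hS
    exact h.pow_notMem hn hS h0 hp
  · exact (Submonoid.pow_mem
      ({ carrier := S, mul_mem' := h.mul_mem, one_mem' := h.one_mem } : Submonoid Dˣ) hS _)

end UHypothesis

/-! ### Coarsening an ordered group at a threshold τ < 1. -/

section Ordered

variable {Γ : Type*} [CommGroup Γ] [LinearOrder Γ] [IsOrderedMonoid Γ] {τ γ δ : Γ}

/-- Some power of `γ` is at most `τ`. -/
def IsSmall (τ γ : Γ) : Prop := ∃ j : ℕ, γ ^ j ≤ τ

/-- All powers of `γ` are less than `τ⁻¹`. -/
def IsLimited (τ γ : Γ) : Prop := ∀ j : ℕ, γ ^ j * τ < 1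

theorem IsSmall.lt_one (hτ : τ < 1) (h : IsSmall τ γ) : γ < 1 := by
  obtain ⟨j, hj⟩ := h
  by_contra! hγ
  exact (hj.trans_lt hτ).not_ge (one_le_pow_of_one_le' hγ j)

theorem IsSmall.exists_forall_le (hτ : τ < 1) (h : IsSmall τ γ) :
    ∃ j : ℕ, ∀ i ≥ j, γ ^ i ≤ τ * τ := by
  have h1 := h.lt_one hτ
  obtain ⟨j, hj⟩ := h
  refine ⟨j + j, fun i hi => (pow_le_pow_right_of_le_one' h1.le hi).trans ?_⟩
  rw [pow_add]
  exact mul_le_mul' hj hj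

theorem isLimited_of_le_one (hτ : τ < 1) (h : γ ≤ 1) : IsLimited τ γ := fun j =>
  mul_lt_one_of_le_of_lt (pow_le_one' h j) hτ

/-- A power of the product is at most the doubled power of the larger factor. -/
theorem IsLimited.mul (h1 : IsLimited τ γ) (h2 : IsLimited τ δ) : IsLimited τ (γ * δ) := by
  rcases le_total γ δ with h | h
  · intro j
    have := h2 (j + j)
    refine lt_of_le_of_lt (mul_le_mul_left ?_ τ) this
    rw [mul_pow, pow_add]
    exact mul_le_mul_left (pow_le_pow_left' h j) _
  · intro j
    have := h1 (j + j)
    refine lt_of_le_of_lt (mul_le_mul_left ?_ τ) this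
    rw [mul_pow, pow_add]
    exact mul_le_mul_right (pow_le_pow_left' h j) _

theorem IsSmall.mul_isLimited (h1 : IsSmall τ γ) (h2 : IsLimited τ δ) : IsSmall τ (γ * δ) := by
  obtain ⟨j, hj⟩ := h1
  refine ⟨j + j, ?_⟩
  calc (γ * δ) ^ (j + j) = γ ^ j * (γ ^ j * δ ^ (j + j)) := by rw [mul_pow, pow_add γ, mul_assoc]
    _ ≤ τ * 1 := mul_le_mul' hj
        ((mul_le_mul_left hj _).trans (by rw [mul_comm]; exact (h2 (j + j)).le))
    _ = τ := mul_one τ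

theorem isSmall_inv_of_not_isLimited (h : ¬ IsLimited τ γ) : IsSmall τ γ⁻¹ := by
  unfold IsLimited at h
  push Not at h
  obtain ⟨j, hj⟩ := h
  refine ⟨j, ?_⟩
  rwa [inv_pow, inv_le_iff_one_le_mul, mul_comm]

end Ordered

theorem lt_one_iff {G Γ : Type*} [Group G] [Group Γ] [LinearOrder Γ] {v : G →* Γ}
    {N : Subgroup G} {S : Set G} (hv : ∀ n ∈ N, 1 ≤ v n ↔ n ∈ S) {n : G} (hn : n ∈ N) :
    v n < 1 ↔ n ∉ S := by
  rw [← hv n hn, not_le]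

theorem map_conj {G A : Type*} [Group G] [CommGroup A] (f : G →* A) (g a : G) :
    f (g * a * g⁻¹) = f a := by
  rw [map_mul, map_mul, map_inv, mul_right_comm, mul_inv_cancel, one_mul]

/-! ### Approximate valuation estimates and congruence subgroups. -/

namespace UHypothesis

variable {D : Type*} [DivisionRing D] {N : Subgroup Dˣ} {S : Set Dˣ} {Γ : Type*} [CommGroup Γ]
  [LinearOrder Γ] [IsOrderedMonoid Γ] {v : Dˣ →* Γ}

theorem conj_mem_ideal [N.Normal] (h : UHypothesis N S) {p : D} (hp : p ∈ h.ideal) (g : Dˣ) :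
    (g : D) * p * (g⁻¹ : Dˣ) ∈ h.ideal := by
  induction hp using AddSubgroup.closure_induction with
  | mem p hp =>
    obtain ⟨n, hn, hnS, rfl⟩ := hp
    exact h.mem_ideal (n := g * n * g⁻¹) (‹N.Normal›.conj_mem _ hn g) (h.conj_notMem hnS g)
  | zero => simp
  | add p q _ _ hp hq => rw [mul_add, add_mul]; exact h.ideal.add_mem hp hq
  | neg p _ hp => rw [mul_neg, neg_mul]; exact h.ideal.neg_mem hp

/-- Right multiplication by `r` maps the ideal to itself. -/
def IsMultiplier (h : UHypothesis N S) (r : D) : Prop := ∀ p ∈ h.ideal, p * r ∈ h.ideal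

theorem isMultiplier_one (h : UHypothesis N S) : h.IsMultiplier 1 := fun p hp => by
  rwa [mul_one]

theorem IsMultiplier.mul {h : UHypothesis N S} {r s : D} (hr : h.IsMultiplier r)
    (hs : h.IsMultiplier s) : h.IsMultiplier (r * s) := fun p hp => by
  rw [← mul_assoc]; exact hs _ (hr p hp)

theorem IsMultiplier.sub {h : UHypothesis N S} {r s : D} (hr : h.IsMultiplier r)
    (hs : h.IsMultiplier s) : h.IsMultiplier (r - s) := fun p hp => by
  rw [mul_sub]; exact h.ideal.sub_mem (hr p hp) (hs p hp)

theorem IsMultiplier.conj [N.Normal] {h : UHypothesis N S} {r : Dˣ} (hr : h.IsMultiplier r)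
    (g : Dˣ) : h.IsMultiplier ((g * r * g⁻¹ : Dˣ) : D) := fun p hp => by
  have h1 := hr _ (h.conj_mem_ideal hp g⁻¹)
  have h2 := h.conj_mem_ideal h1 g
  have e : (g : D) * ((g⁻¹ : Dˣ) * p * (g⁻¹⁻¹ : Dˣ) * r) * (g⁻¹ : Dˣ) =
      p * ((g * r * g⁻¹ : Dˣ) : D) := by
    simp [mul_assoc]
  rwa [e] at h2

theorem isMultiplier_of_mem_unitGroup (h : UHypothesis N S) {u : Dˣ} (hu : u ∈ h.unitGroup) :
    h.IsMultiplier u := fun p hp => by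
  induction hp using AddSubgroup.closure_induction with
  | mem p hp =>
    obtain ⟨n, hn, hnS, rfl⟩ := hp
    rw [← Units.val_mul]
    exact h.mem_ideal (N.mul_mem hn (h.mem_group hu.1)) (h.mul_notMem hnS hu.2)
  | zero => simp
  | add p q _ _ hp hq => rw [add_mul]; exact h.ideal.add_mem hp hq
  | neg p _ hp => rw [neg_mul]; exact h.ideal.neg_mem hp

theorem one_mem_addSet_of_mem_ideal (h : UHypothesis N S) {a : Dˣ} (ha : (a : D) ∈ h.ideal) :
    1 ∈ addSet N a := by
  obtain ⟨w, hw, hw'⟩ := h.exists_unit_eq_add ha 1 h.unitGroup.one_mem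
  exact ⟨N.one_mem, w, h.mem_group hw.1, by rw [hw', add_comm]⟩

theorem mem_unitGroup_iff (h : UHypothesis N S) (hv : ∀ n ∈ N, 1 ≤ v n ↔ n ∈ S) {n : Dˣ}
    (hn : n ∈ N) : n ∈ h.unitGroup ↔ v n = 1 := by
  rw [h.mem_unitGroup, ← hv n hn, ← hv _ (N.inv_mem hn), map_inv, one_le_inv', le_antisymm_iff,
    and_comm]

theorem mem_ideal_of_lt_one {Γ : Type*} [CommGroup Γ] [LinearOrder Γ] {v : Dˣ →* Γ}
    (h : UHypothesis N S) (hv : ∀ n ∈ N, 1 ≤ v n ↔ n ∈ S) {n : Dˣ}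
    (hn : n ∈ N) (hlt : v n < 1) : (n : D) ∈ h.ideal :=
  h.mem_ideal hn ((lt_one_iff hv hn).1 hlt)

theorem map_neg (h : UHypothesis N S) (hv : ∀ n ∈ N, 1 ≤ v n ↔ n ∈ S) (a : Dˣ) :
    v (-a) = v a := by
  rw [← neg_one_mul, map_mul, (h.mem_unitGroup_iff hv (h.mem_group h.neg_one_mem)).1
    (h.neg_mem_unitGroup h.unitGroup.one_mem), one_mul]

/-- If v k < 1, then -a = 1 - k ∈ N; if v k > 1, then k⁻¹a = 1 - k⁻¹ ∈ N. Either contradicts a ∉ N.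
-/
theorem mem_unitGroup_of_eq_add_one (h : UHypothesis N S) (hv : ∀ n ∈ N, 1 ≤ v n ↔ n ∈ S)
    {a k : Dˣ} (ha : a ∉ N) (hk : k ∈ N) (hka : (k : D) = a + 1) : k ∈ h.unitGroup := by
  have hneg : (-1 : Dˣ) ∈ N := h.mem_group h.neg_one_mem
  rw [h.mem_unitGroup_iff hv hk]
  rcases lt_trichotomy (v k) 1 with hlt | heq | hgt
  · obtain ⟨w, hw, hw'⟩ := h.exists_unit_eq_add
      (h.ideal.neg_mem (h.mem_ideal_of_lt_one hv hk hlt)) 1 h.unitGroup.one_mem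
    refine absurd ?_ ha
    have : a = -w := Units.ext (by rw [Units.val_neg, hw', hka, Units.val_one]; abel)
    rw [this]
    exact neg_mem_of_neg_one_mem hneg (h.mem_group hw.1)
  · exact heq
  · obtain ⟨w, hw, hw'⟩ := h.exists_unit_eq_add
      (h.ideal.neg_mem (h.mem_ideal_of_lt_one hv (N.inv_mem hk)
        (by rw [map_inv]; exact inv_lt_one'.2 hgt))) 1 h.unitGroup.one_mem
    refine absurd ?_ ha
    have : a = k * w := Units.ext (by
      rw [Units.val_mul, hw', Units.val_one, mul_add, mul_one, mul_neg, Units.mul_inv, hka]; abel)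
    rw [this]
    exact N.mul_mem hk (h.mem_group hw.1)

theorem isMultiplier_of_one_mem_addSet (h : UHypothesis N S) (hv : ∀ n ∈ N, 1 ≤ v n ↔ n ∈ S)
    {a : Dˣ} (ha : a ∉ N) (h1 : 1 ∈ addSet N a) : h.IsMultiplier (a : D) := by
  obtain ⟨-, k, hk, hk'⟩ := h1
  rw [Units.val_one] at hk'
  have := (h.isMultiplier_of_mem_unitGroup (h.mem_unitGroup_of_eq_add_one hv ha hk hk')).sub
    h.isMultiplier_one
  rwa [hk', add_sub_cancel_right] at this

variable (N v) in
/-- Every `a` with `v a ≤ v t` satisfies `a + 1 ∈ N`. -/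
structure IsBound (t : Dˣ) : Prop where
  mem : t ∈ N
  lt_one : v t < 1
  one_mem : ∀ a : Dˣ, v a ≤ v t → 1 ∈ addSet N a

section Bound

variable {t : Dˣ}

/-- Outside N, write a = t(t⁻¹a): one factor v t puts t in the ideal, the other makes t⁻¹a a
multiplier. -/
theorem mem_ideal_of_le (h : UHypothesis N S) (hv : ∀ n ∈ N, 1 ≤ v n ↔ n ∈ S) (ht : IsBound N v t)
    {a : Dˣ} (ha : v a ≤ v t * v t) : (a : D) ∈ h.ideal := by
  by_cases haN : a ∈ N
  · exact h.mem_ideal_of_lt_one hv haN (ha.trans_lt (mul_lt_one' ht.lt_one ht.lt_one))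
  · have h1 : v (t⁻¹ * a) ≤ v t := by
      rw [map_mul, map_inv, inv_mul_le_iff_le_mul]; exact ha
    have h2 : t⁻¹ * a ∉ N := fun h' => haN (by simpa using N.mul_mem ht.mem h')
    have := h.isMultiplier_of_one_mem_addSet hv h2 (ht.one_mem _ h1) t
      (h.mem_ideal_of_lt_one hv ht.mem ht.lt_one)
    rwa [← Units.val_mul, mul_inv_cancel_left] at this

/-- The elements would commute, and every term in the expansion of a high power of b + c would lie
in the ideal, which does not contain 1. -/
theorem add_ne_one_of_isSmall (h : UHypothesis N S) (hv : ∀ n ∈ N, 1 ≤ v n ↔ n ∈ S)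
    (ht : IsBound N v t) {b c : Dˣ} (hb : IsSmall (v t) (v b)) (hc : IsSmall (v t) (v c)) :
    (b : D) + c ≠ 1 := by
  intro hbc
  have hcomm : Commute (b : D) c := by
    have : (c : D) = 1 - b := by rw [← hbc]; abel
    rw [this]
    exact (Commute.one_right _).sub_right (Commute.refl _)
  have hb1 := (hb.lt_one ht.lt_one).le
  have hc1 := (hc.lt_one ht.lt_one).le
  obtain ⟨i, hi⟩ := hb.exists_forall_le ht.lt_one
  obtain ⟨j, hj⟩ := hc.exists_forall_le ht.lt_one
  refine h.one_notMem_ideal ?_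
  rw [← one_pow (i + j), ← hbc, hcomm.add_pow]
  refine sum_mem fun m hm => ?_
  rw [← (Nat.cast_commute _ _).eq, ← nsmul_eq_mul]
  refine h.ideal.nsmul_mem ?_ _
  have : (b : D) ^ m * (c : D) ^ (i + j - m) = ((b ^ m * c ^ (i + j - m) : Dˣ) : D) := by simp
  rw [this]
  refine h.mem_ideal_of_le hv ht ?_
  rw [map_mul, map_pow, map_pow]
  rcases le_total i m with him | him
  · exact mul_le_of_le_of_le_one (hi m him) (pow_le_one' hc1 _)
  · exact mul_le_of_le_one_of_le (pow_le_one' hb1 _) (hj _ (by omega))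

/-- Otherwise b⁻¹ and b⁻¹a are both small, but their sum is 1. This weak triangle inequality
replaces the ultrametric one. -/
theorem isLimited_add_one (h : UHypothesis N S) (hv : ∀ n ∈ N, 1 ≤ v n ↔ n ∈ S)
    (ht : IsBound N v t) {a b : Dˣ} (ha : IsLimited (v t) (v a)) (hb : (b : D) = a + 1) :
    IsLimited (v t) (v b) := by
  by_contra hcon
  have h1 : IsSmall (v t) (v b⁻¹) := by rw [map_inv]; exact isSmall_inv_of_not_isLimited hcon
  have h2 : IsSmall (v t) (v (b⁻¹ * a)) := by rw [map_mul]; exact h1.mul_isLimited ha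
  refine h.add_ne_one_of_isSmall hv ht h2 h1 ?_
  rw [Units.val_mul]
  nth_rw 2 [← mul_one ((b⁻¹ : Dˣ) : D)]
  rw [← mul_add, ← hb, Units.inv_mul]

variable (v t) in
/-- The values of `d` and `c` differ by a limited factor, or `d = 0`. -/
def InBall (c : Dˣ) (d : D) : Prop := ∀ u : Dˣ, (u : D) = d → IsLimited (v t) (v u * (v c)⁻¹)

theorem InBall.add (h : UHypothesis N S) (hv : ∀ n ∈ N, 1 ≤ v n ↔ n ∈ S)
    (ht : IsBound N v t) {c : Dˣ} {d e : D} (hd : InBall v t c d) (he : InBall v t c e) :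
    InBall v t c (d + e) := by
  -- Divide by the summand of larger value; the quotient is 1 plus an element of value at most 1.
  have key : ∀ u a b : Dˣ, (u : D) = b + a → v b ≤ v a → IsLimited (v t) (v a * (v c)⁻¹) →
      IsLimited (v t) (v u * (v c)⁻¹) := by
    intro u a b hu hle ha
    have h1 : IsLimited (v t) (v (u * a⁻¹)) := by
      refine h.isLimited_add_one hv ht (a := b * a⁻¹) (isLimited_of_le_one ht.lt_one ?_) ?_
      · rw [map_mul, map_inv, mul_inv_le_iff_le_mul, one_mul]; exact hle
      · rw [Units.val_mul, hu, add_mul, Units.mul_inv, Units.val_mul]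
    have := h1.mul ha
    rw [map_mul, map_inv] at this
    simpa [mul_assoc] using this
  intro u hu
  by_cases hd0 : d = 0
  · exact he u (by rw [hu, hd0, zero_add])
  by_cases he0 : e = 0
  · exact hd u (by rw [hu, he0, add_zero])
  rcases le_total (v (Units.mk0 d hd0)) (v (Units.mk0 e he0)) with hle | hle
  · exact key u _ _ hu hle (he _ rfl)
  · exact key u _ _ (by rw [hu, add_comm]; rfl) hle (hd _ rfl)

theorem InBall.mul {c c' : Dˣ} {d e : D} (hd : InBall v t c d) (he : InBall v t c' e) :
    InBall v t (c * c') (d * e) := by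
  intro u hu
  have hd0 : d ≠ 0 := by rintro rfl; exact u.ne_zero (by rw [hu, zero_mul])
  have he0 : e ≠ 0 := by rintro rfl; exact u.ne_zero (by rw [hu, mul_zero])
  have hu' : u = Units.mk0 d hd0 * Units.mk0 e he0 := Units.ext hu
  have := (hd (Units.mk0 d hd0) rfl).mul (he (Units.mk0 e he0) rfl)
  rw [hu', map_mul, map_mul, mul_inv, mul_mul_mul_comm]
  exact this

theorem InBall.neg (h : UHypothesis N S) (hv : ∀ n ∈ N, 1 ≤ v n ↔ n ∈ S) {c : Dˣ} {d : D}
    (hd : InBall v t c d) : InBall v t c (-d) := by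
  intro u hu
  rw [← h.map_neg hv u]
  exact hd _ (by rw [Units.val_neg, hu, neg_neg])

theorem InBall.of_isSmall (ht : v t < 1) {c : Dˣ} {d : D} (hc : IsSmall (v t) (v c))
    (hd : InBall v t c d) : InBall v t 1 d := by
  intro u hu
  have := (hd u hu).mul (isLimited_of_le_one ht (hc.lt_one ht).le)
  simpa using this

theorem inBall_self (ht : v t < 1) (c : Dˣ) : InBall v t c (c : D) := by
  intro u hu
  rw [Units.ext hu, mul_inv_cancel]
  exact isLimited_of_le_one ht le_rfl

theorem InBall.conj {Γ : Type*} [CommGroup Γ] [LinearOrder Γ] {v : Dˣ →* Γ} {c : Dˣ} {d : D} (hd : InBall v t c d) (g : Dˣ) :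
    InBall v t c ((g : D) * d * (g⁻¹ : Dˣ)) := by
  intro u hu
  have := hd (g⁻¹ * u * g⁻¹⁻¹) (by rw [Units.val_mul, Units.val_mul, hu]; simp [mul_assoc])
  rwa [map_conj] at this

/-- If g⁻¹ were not limited, g and 1 - g would both be small with sum 1. -/
theorem inBall_one_of_sub_one (h : UHypothesis N S) (hv : ∀ n ∈ N, 1 ≤ v n ↔ n ∈ S)
    (ht : IsBound N v t) {c g : Dˣ} (hc : IsSmall (v t) (v c)) (hg : InBall v t c ((g : D) - 1)) :
    InBall v t 1 (g : D) ∧ InBall v t 1 ((g⁻¹ : Dˣ) : D) := by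
  have h1 := inBall_self ht.lt_one (1 : Dˣ)
  have h2 := InBall.add h hv ht (hg.of_isSmall ht.lt_one hc) h1
  refine ⟨by simpa using h2, fun u hu => ?_⟩
  rw [Units.ext hu, map_inv, map_one, inv_one, mul_one]
  by_contra hcon
  have h3 := isSmall_inv_of_not_isLimited hcon
  rw [inv_inv] at h3
  by_cases hg1 : g = 1
  · rw [hg1, map_one] at h3
    exact (h3.lt_one ht.lt_one).ne rfl
  · have hne : 1 - (g : D) ≠ 0 := fun h0 => hg1 (Units.ext (sub_eq_zero.1 h0).symm)
    have h4 : IsSmall (v t) (v (Units.mk0 _ hne)) := by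
      have := hc.mul_isLimited (InBall.neg h hv hg (Units.mk0 _ hne) (by simp))
      rwa [mul_comm (v _), mul_assoc, mul_comm _ (v c), mul_inv_cancel, mul_one] at this
    exact h.add_ne_one_of_isSmall hv ht h3 h4 (by simp)

/-- The group of all `g` for which `g - 1` lies in the ball given by `c`. -/
def congruenceGroup (h : UHypothesis N S) (hv : ∀ n ∈ N, 1 ≤ v n ↔ n ∈ S) (ht : IsBound N v t)
    {c : Dˣ} (hc : IsSmall (v t) (v c)) : Subgroup Dˣ where
  carrier := {g | InBall v t c ((g : D) - 1)}
  one_mem' := fun u hu => absurd hu (by simp)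
  mul_mem' {a b} ha hb := by
    have h1 := (h.inBall_one_of_sub_one hv ht hc ha).1.mul hb
    rw [one_mul] at h1
    have := InBall.add h hv ht h1 ha
    have e : (a : D) * ((b : D) - 1) + ((a : D) - 1) = ((a * b : Dˣ) : D) - 1 := by
      rw [Units.val_mul]; noncomm_ring
    rwa [e] at this
  inv_mem' {a} ha := by
    have h1 := InBall.neg h hv ((h.inBall_one_of_sub_one hv ht hc ha).2.mul ha)
    rw [one_mul, mul_sub, Units.inv_mul, mul_one, neg_sub] at h1
    exact h1

theorem mem_congruenceGroup (h : UHypothesis N S) (hv : ∀ n ∈ N, 1 ≤ v n ↔ n ∈ S)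
    (ht : IsBound N v t) {c : Dˣ} (hc : IsSmall (v t) (v c)) {g : Dˣ} :
    g ∈ h.congruenceGroup hv ht hc ↔ InBall v t c ((g : D) - 1) := Iff.rfl

theorem congruenceGroup_normal (h : UHypothesis N S) (hv : ∀ n ∈ N, 1 ≤ v n ↔ n ∈ S)
    (ht : IsBound N v t) {c : Dˣ} (hc : IsSmall (v t) (v c)) :
    (h.congruenceGroup hv ht hc).Normal := by
  refine ⟨fun a ha g => ?_⟩
  rw [mem_congruenceGroup] at ha ⊢
  have := ha.conj g
  rwa [mul_sub, mul_one, sub_mul, Units.mul_inv] at this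

-- From ab - ba = (a - 1)(b - 1) - (b - 1)(a - 1), divided by ba: commutators are congruent to 1 to
-- twice the depth.
open scoped commutatorElement in
theorem commutator_mem_congruenceGroup (h : UHypothesis N S) (hv : ∀ n ∈ N, 1 ≤ v n ↔ n ∈ S)
    (ht : IsBound N v t) {c : Dˣ} (hc : IsSmall (v t) (v c)) (hcc : IsSmall (v t) (v (c * c)))
    {a b : Dˣ} (ha : a ∈ h.congruenceGroup hv ht hc) (hb : b ∈ h.congruenceGroup hv ht hc) :
    ⁅a, b⁆ ∈ h.congruenceGroup hv ht hcc := by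
  have h1 := (h.inBall_one_of_sub_one hv ht hc (Subgroup.mul_mem _ hb ha)).2
  rw [mem_congruenceGroup] at ha hb ⊢
  have h2 := (InBall.add h hv ht (ha.mul hb) (InBall.neg h hv (hb.mul ha))).mul h1
  rw [mul_one] at h2
  have e : (((a : D) - 1) * ((b : D) - 1) + -(((b : D) - 1) * ((a : D) - 1))) *
      (((b * a)⁻¹ : Dˣ) : D) = ((⁅a, b⁆ : Dˣ) : D) - 1 := by
    have e1 : ((a : D) - 1) * ((b : D) - 1) + -(((b : D) - 1) * ((a : D) - 1)) =
        ((a * b : Dˣ) : D) - ((b * a : Dˣ) : D) := by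
      rw [Units.val_mul, Units.val_mul]; noncomm_ring
    rw [e1, sub_mul, Units.mul_inv, ← Units.val_mul, commutatorElement_def, mul_inv_rev]
    simp only [mul_assoc]
  rwa [e] at h2

variable [N.Normal] [IsSimpleGroup (Dˣ ⧸ N)]

-- The image in the simple group G/N is trivial or everything. In the second case the commutators,
-- which lie in N, would make G/N abelian.
open scoped commutatorElement in
theorem congruenceGroup_le_of_le (hna : ∃ x y : Dˣ ⧸ N, x * y ≠ y * x) (h : UHypothesis N S)
    (hv : ∀ n ∈ N, 1 ≤ v n ↔ n ∈ S) (ht : IsBound N v t) {c : Dˣ} (hc : IsSmall (v t) (v c))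
    (hcc : IsSmall (v t) (v (c * c))) (hle : h.congruenceGroup hv ht hcc ≤ N) :
    h.congruenceGroup hv ht hc ≤ N := by
  have hn : ((h.congruenceGroup hv ht hc).map (QuotientGroup.mk' N)).Normal :=
    (h.congruenceGroup_normal hv ht hc).map _ (QuotientGroup.mk'_surjective N)
  rcases IsSimpleGroup.eq_bot_or_eq_top_of_normal _ hn with h0 | h0
  · intro g hg
    have := Subgroup.mem_map_of_mem (QuotientGroup.mk' N) hg
    rw [h0, Subgroup.mem_bot] at this
    exact (QuotientGroup.eq_one_iff g).1 this
  · obtain ⟨x, y, hxy⟩ := hna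
    have hx : x ∈ (h.congruenceGroup hv ht hc).map (QuotientGroup.mk' N) := h0 ▸ Subgroup.mem_top x
    have hy : y ∈ (h.congruenceGroup hv ht hc).map (QuotientGroup.mk' N) := h0 ▸ Subgroup.mem_top y
    obtain ⟨a, ha, rfl⟩ := hx
    obtain ⟨b, hb, rfl⟩ := hy
    have hab := hle (h.commutator_mem_congruenceGroup hv ht hc hcc ha hb)
    rw [← QuotientGroup.eq_one_iff] at hab
    refine absurd ?_ hxy
    rw [← commutatorElement_eq_one_iff_mul_comm, ← map_commutatorElement]
    exact hab

theorem congruenceGroup_le (hna : ∃ x y : Dˣ ⧸ N, x * y ≠ y * x) (h : UHypothesis N S)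
    (hv : ∀ n ∈ N, 1 ≤ v n ↔ n ∈ S) (ht : IsBound N v t) (k : ℕ) :
    ∀ (c : Dˣ) (hc : IsSmall (v t) (v c)), v c ^ 2 ^ k ≤ v t * v t →
      h.congruenceGroup hv ht hc ≤ N := by
  induction k with
  | zero =>
    intro c hc hle g hg
    by_cases hg1 : g = 1
    · rw [hg1]; exact N.one_mem
    obtain ⟨u, hu⟩ := exists_val_eq_sub hg1
    rw [pow_zero, pow_one] at hle
    have h1 := (mem_congruenceGroup h hv ht hc).1 hg u (by rw [hu, Units.val_one]) 1
    -- The exponent 1 in the ball condition gives v u · v t < v c ≤ v t · v t.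
    have h2 : v u ≤ v t := by
      rw [pow_one, mul_right_comm, mul_inv_lt_iff_lt_mul, one_mul] at h1
      exact (lt_of_mul_lt_mul_right' (h1.trans_le hle)).le
    obtain ⟨-, m, hm, hm'⟩ := ht.one_mem u h2
    have : g = m := Units.ext (by rw [hm', hu]; simp)
    rwa [this]
  | succ k ih =>
    intro c hc hle
    have hcc : IsSmall (v t) (v (c * c)) := by
      rw [map_mul]
      exact hc.mul_isLimited (isLimited_of_le_one ht.lt_one (hc.lt_one ht.lt_one).le)
    refine h.congruenceGroup_le_of_le hna hv ht hc hcc (ih _ hcc ?_)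
    rwa [map_mul, ← pow_two, ← pow_mul, ← pow_succ']

/-- If `v c` has a power that is at most the bound `v t`, then `c + 1 ∈ N`. -/
theorem one_mem_addSet_of_isSmall (hna : ∃ x y : Dˣ ⧸ N, x * y ≠ y * x) (h : UHypothesis N S)
    (hv : ∀ n ∈ N, 1 ≤ v n ↔ n ∈ S) (ht : IsBound N v t) {c : Dˣ} (hc : IsSmall (v t) (v c)) :
    1 ∈ addSet N c := by
  obtain ⟨j, hj⟩ := hc.exists_forall_le ht.lt_one
  have hle := h.congruenceGroup_le hna hv ht j c hc (hj _ Nat.lt_two_pow_self.le)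
  have hne : (c : D) + 1 ≠ 0 := by
    intro h0
    have : c = -1 := Units.ext (by rw [Units.val_neg]; exact eq_neg_of_add_eq_zero_left h0)
    have h1 := hc.lt_one ht.lt_one
    rw [this, h.map_neg hv, map_one] at h1
    exact h1.ne rfl
  refine ⟨N.one_mem, Units.mk0 _ hne, hle ?_, rfl⟩
  rw [mem_congruenceGroup, Units.val_mk0, add_sub_cancel_right]
  exact inBall_self ht.lt_one c

end Bound

/-! ### Products of conjugates reach every coset. -/

section Words

variable {D : Type*} [DivisionRing D] {N : Subgroup Dˣ} [N.Normal] {S : Set Dˣ} {Γ : Type*}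
  [CommGroup Γ] {v : Dˣ →* Γ}

/-- The products of conjugates of a multiplier `b ∉ N` represent all cosets of `N`. -/
theorem exists_isMultiplier_mk_eq [Finite (Dˣ ⧸ N)] [IsSimpleGroup (Dˣ ⧸ N)]
    (h : UHypothesis N S) {b : Dˣ} (hb : b ∉ N) (hbm : h.IsMultiplier (b : D)) (x : Dˣ ⧸ N) :
    ∃ (j : ℕ) (w : Dˣ), (w : Dˣ ⧸ N) = x ∧ h.IsMultiplier (w : D) ∧ v w = v b ^ j := by
  let M : Submonoid (Dˣ ⧸ N) :=
    { carrier := {x | ∃ (j : ℕ) (w : Dˣ), (w : Dˣ ⧸ N) = x ∧ h.IsMultiplier (w : D) ∧ v w = v b ^ j}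
      one_mem' := ⟨0, 1, rfl, h.isMultiplier_one, by simp⟩
      mul_mem' := by
        rintro _ _ ⟨i, w, rfl, hw, hvw⟩ ⟨j, z, rfl, hz, hvz⟩
        exact ⟨i + j, w * z, rfl, by rw [Units.val_mul]; exact hw.mul hz,
          by rw [map_mul, hvw, hvz, pow_add]⟩ }
  let H : Subgroup (Dˣ ⧸ N) :=
    { M with
      inv_mem' := fun {x} hx => by
        have : x⁻¹ = x ^ (orderOf x - 1) := by
          rw [inv_eq_iff_mul_eq_one, ← pow_succ', Nat.sub_add_cancel (orderOf_pos x),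
            pow_orderOf_eq_one]
        rw [this]
        exact M.pow_mem hx _ }
  have hH : H.Normal := by
    refine ⟨?_⟩
    rintro _ ⟨j, w, rfl, hw, hvw⟩ y
    obtain ⟨g, rfl⟩ := QuotientGroup.mk_surjective y
    exact ⟨j, g * w * g⁻¹, rfl, hw.conj g, by rw [map_conj, hvw]⟩
  have hbH : (b : Dˣ ⧸ N) ∈ H := ⟨1, b, rfl, hbm, (pow_one _).symm⟩
  rcases hH.eq_bot_or_eq_top with h0 | h0
  · rw [h0, Subgroup.mem_bot, QuotientGroup.eq_one_iff] at hbH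
    exact absurd hbH hb
  · have : x ∈ H := h0 ▸ Subgroup.mem_top x
    exact this

end Words

theorem map_eq_one_of_mem_commutator {G A : Type*} [Group G] [CommGroup A] (f : G →* A) {c : G}
    (hc : c ∈ commutator G) : f c = 1 := Abelianization.commutator_subset_ker f hc

theorem exists_mem_map_eq {G A : Type*} [Group G] [CommGroup A] {N : Subgroup G} [N.Normal]
    [IsSimpleGroup (G ⧸ N)] (hna : ∃ x y : G ⧸ N, x * y ≠ y * x) (f : G →* A) (g : G) :
    ∃ n ∈ N, f n = f g := by
  obtain ⟨c, hc, hcg⟩ := exists_commutator_mk_eq hna (g : G ⧸ N)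
  refine ⟨g * c⁻¹, ?_, ?_⟩
  · rw [← QuotientGroup.eq_one_iff, QuotientGroup.mk_mul, QuotientGroup.mk_inv, hcg,
      mul_inv_cancel]
  · rw [map_mul, map_inv, map_eq_one_of_mem_commutator f hc, inv_one, mul_one]

/-! ### Elements of value below 1, and the conclusion. -/

section Valuation

variable {D : Type*} [DivisionRing D] {N : Subgroup Dˣ} [N.Normal] {C : ConjClasses (Dˣ ⧸ N)}
  {Γ : Type*} [CommGroup Γ] [LinearOrder Γ] [IsOrderedMonoid Γ] {v : Dˣ →* Γ}

/-- Write a = (aw⁻¹)w: the first factor is an infinitesimal of N and w preserves the ideal. -/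
theorem one_mem_addSet_of_word {S : Set Dˣ} (h : UHypothesis N S)
    (hv : ∀ n ∈ N, 1 ≤ v n ↔ n ∈ S) {a w : Dˣ} (hw : (w : Dˣ ⧸ N) = a)
    (hwm : h.IsMultiplier (w : D)) (hlt : v a < v w) : 1 ∈ addSet N a := by
  have hn : a * w⁻¹ ∈ N := by
    rw [← QuotientGroup.eq_one_iff, QuotientGroup.mk_mul, QuotientGroup.mk_inv, hw,
      mul_inv_cancel]
  have := hwm _ (h.mem_ideal_of_lt_one hv hn
    (by rw [map_mul, map_inv, mul_inv_lt_iff_lt_mul, one_mul]; exact hlt))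
  rw [← Units.val_mul, inv_mul_cancel_right] at this
  exact h.one_mem_addSet_of_mem_ideal this

theorem one_lt_of_mem_mClass (hv : ∀ n ∈ N, 1 ≤ v n ↔ n ∈ nClass N C) {m : Dˣ} (hm : m ∈ mClass N C) :
    1 < v m := by
  have hmN := (mem_nClass.1 hm.1).1
  rw [← inv_lt_one', ← map_inv, lt_one_iff hv (N.inv_mem hmN)]
  exact fun h => hm.2 ⟨hmN, hm.1, h⟩

variable [Finite (Dˣ ⧸ N)] [IsSimpleGroup (Dˣ ⧸ N)]

/-- All `a` with `v a < 1` satisfy `a + 1 ∈ N`. -/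
theorem one_mem_addSet_of_lt_one (hna : ∃ x y : Dˣ ⧸ N, x * y ≠ y * x)
    (hC : C ≠ ConjClasses.mk 1) (h : UHypothesis N (nClass N C))
    (hv : ∀ n ∈ N, 1 ≤ v n ↔ n ∈ nClass N C) {a : Dˣ} (ha : v a < 1) : 1 ∈ addSet N a := by
  obtain ⟨d, hd, hda⟩ := exists_mem_map_eq hna v a
  have hdS : d ∉ nClass N C := (lt_one_iff hv hd).1 (hda ▸ ha)
  have hex : ∃ b ∈ pClass N C, d ∉ addSet N b := by
    by_contra! hcon
    exact hdS (mem_nClass.2 ⟨hd, hcon⟩)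
  obtain ⟨b, hb, hdb⟩ := hex
  have hbN := notMem_of_mem_pClass hC hb
  have hword := h.exists_isMultiplier_mk_eq (v := v) hbN
    (h.isMultiplier_of_one_mem_addSet hv hbN (mem_pClass.1 hb).2)
  choose j w hwx hwm hvw using hword
  rcases le_or_gt 1 (v b) with hb1 | hb1
  · refine h.one_mem_addSet_of_word hv (hwx a) (hwm a) (ha.trans_le ?_)
    rw [hvw]
    exact one_le_pow_of_one_le' hb1 _
  -- Finiteness of G/N bounds the word lengths, so one threshold serves all cosets; the exponent J +
  -- 1 keeps the inequality strict.
  obtain ⟨J, hJ⟩ : ∃ J : ℕ, ∀ x, j x ≤ J := by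
    obtain ⟨J, hJ⟩ := (Set.finite_range j).bddAbove
    exact ⟨J, fun x => hJ ⟨x, rfl⟩⟩
  obtain ⟨k, hk, hkb⟩ := exists_mem_map_eq hna v b
  have ht : IsBound N v (k ^ (J + 1)) := by
    refine ⟨N.pow_mem hk _, ?_, fun c hc => ?_⟩
    · rw [map_pow, hkb]; exact pow_lt_one' hb1 (Nat.succ_ne_zero J)
    · refine h.one_mem_addSet_of_word hv (hwx c) (hwm c) (hc.trans_lt ?_)
      rw [hvw, map_pow, hkb]
      calc v b ^ (J + 1) = v b ^ (J + 1 - j c) * v b ^ j c := by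
            rw [← pow_add, Nat.sub_add_cancel ((hJ c).trans J.le_succ)]
        _ < 1 * v b ^ j c := mul_lt_mul_left (pow_lt_one' hb1 (by have := hJ c; omega)) _
        _ = v b ^ j c := one_mul _
  by_contra hcon
  have hsmall : ¬ IsSmall (v (k ^ (J + 1))) (v a) := fun hs =>
    hcon (h.one_mem_addSet_of_isSmall hna hv ht hs)
  unfold IsSmall at hsmall
  push Not at hsmall
  -- As a is not small, v a to the power 2(J + 1) exceeds v b to the power J + 1. Division by d, of
  -- the same value as a, thus leaves b small, and d ∈ N(b) follows, a contradiction.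
  have hs : IsSmall (v (k ^ (J + 1))) (v (d⁻¹ * b)) := by
    refine ⟨(J + 1) + (J + 1), ?_⟩
    have h1 := (hsmall ((J + 1) + (J + 1))).le
    rw [map_mul, map_inv, hda, mul_pow, inv_pow, inv_mul_le_iff_le_mul, pow_add (v b),
      map_pow, hkb]
    rw [map_pow, hkb] at h1
    exact mul_le_mul_left h1 _
  have := h.one_mem_addSet_of_isSmall hna hv ht hs
  rw [mem_addSet_mul_iff (N.inv_mem hd)] at this
  exact hdb (by simpa using this)

theorem mem_addSet_of_lt (hna : ∃ x y : Dˣ ⧸ N, x * y ≠ y * x) (hC : C ≠ ConjClasses.mk 1)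
    (h : UHypothesis N (nClass N C)) (hv : ∀ n ∈ N, 1 ≤ v n ↔ n ∈ nClass N C) {a m : Dˣ}
    (hm : m ∈ N) (hlt : v a < v m) : m ∈ addSet N a := by
  have := h.one_mem_addSet_of_lt_one hna hC hv (a := m⁻¹ * a)
    (by rw [map_mul, map_inv, inv_mul_lt_iff_lt_mul, mul_one]; exact hlt)
  rw [mem_addSet_mul_iff (N.inv_mem hm)] at this
  simpa using this

end Valuation

theorem kHat_nonempty (F : Type*) {D : Type*} [Field F] [DivisionRing D] [Algebra F D]
    [Algebra.IsCentral F D] [FiniteDimensional F D] {N : Subgroup Dˣ} [N.Normal]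
    [Finite (Dˣ ⧸ N)] [IsSimpleGroup (Dˣ ⧸ N)] {C : ConjClasses (Dˣ ⧸ N)}
    (hna : ∃ x y : Dˣ ⧸ N, x * y ≠ y * x)
    (hC : C ≠ ConjClasses.mk 1) (h : UHypothesis N (nClass N C)) : (kHat F N C).Nonempty := by
  obtain ⟨Γ, _, _, _, v, hv⟩ := h.exists_valuation (F := F) hna
  obtain ⟨b, hb⟩ := exists_mk_eq C
  obtain ⟨c, hc, hcb⟩ := exists_commutator_mk_eq hna (b : Dˣ ⧸ N)
  refine ⟨c, ⟨?_, fun hcN => ?_⟩, fun m hm => ?_⟩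
  · refine Set.mem_mul.2 ⟨c, ?_, 1, ⟨N.one_mem, one_mem_nClass, by simpa using one_mem_nClass⟩,
      mul_one c⟩
    have := map_eq_one_of_mem_commutator (Units.map (reducedNorm F D)) hc
    exact congrArg Units.val this
  · have hcN : c ∈ N := hcN
    rw [(QuotientGroup.eq_one_iff c).2 hcN] at hcb
    exact hC (by rw [← hb, ← hcb])
  · refine h.mem_addSet_of_lt hna hC hv (mem_nClass.1 hm.1).1 ?_
    rw [map_eq_one_of_mem_commutator v hc]
    exact one_lt_of_mem_mClass hv hm

/-- The second alternative holds: v z > 1 would put -1 in N(z⁻¹), so every z in 𝕆_z has value at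
most 1, below that of any m in 𝕄. -/
theorem isBalancedClass (F : Type*) {D : Type*} [Field F] [DivisionRing D] [Algebra F D]
    [FiniteDimensional F D] {N : Subgroup Dˣ} [N.Normal] [Finite (Dˣ ⧸ N)]
    [IsSimpleGroup (Dˣ ⧸ N)] {C : ConjClasses (Dˣ ⧸ N)} (hna : ∃ x y : Dˣ ⧸ N, x * y ≠ y * x)
    (hC : C ≠ ConjClasses.mk 1) (h : UHypothesis N (nClass N C)) : IsBalancedClass N C := by
  obtain ⟨Γ, _, _, _, v, hv⟩ := h.exists_valuation (F := F) hna
  obtain ⟨b, hb⟩ := exists_mk_eq C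
  refine ⟨hC, h, Or.inr fun m hm => ⟨b, ConjClasses.mem_carrier_iff_mk_eq.2 hb, ?_⟩⟩
  rintro z ⟨-, hz⟩
  refine h.mem_addSet_of_lt hna hC hv (mem_nClass.1 hm.1).1
    (lt_of_le_of_lt (not_lt.1 fun hlt => hz (Or.inr ?_)) (one_lt_of_mem_mClass hv hm))
  refine h.mem_addSet_of_lt hna hC hv (h.mem_group h.neg_one_mem) ?_
  rw [h.map_neg hv, map_one, map_inv]
  exact inv_lt_one'.2 hlt

end UHypothesis

/-! ### Existence of the classes from the graph conditions. -/

section Existence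

variable {D : Type*} [DivisionRing D] {N : Subgroup Dˣ} [N.Normal]

theorem isDistantPair_of_distGT (hneg : (-1 : Dˣ) ∈ N) (hne : ∀ a : Dˣ, (addSet N a).Nonempty)
    {x y : Dˣ ⧸ N} (hd : DistGT 4 x y)
    (h : ∀ b ∈ pSet N y, ∃ a ∈ pSet N x, addSet N a ⊆ addSet N b) :
    IsDistantPair N (ConjClasses.mk x) (ConjClasses.mk y) := by
  refine ⟨mk_ne_mk_one hd.1, mk_ne_mk_one hd.2.1, uHypothesis_of_comparable hneg hne hd.2.1
    (hd.far4.comparable hneg) (hd.far4.subOneMem hneg) h, fun b hb => ?_⟩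
  obtain ⟨g, hg⟩ := exists_conj_mem_pSet hb
  obtain ⟨a, ha, hab⟩ := h _ hg
  refine ⟨g⁻¹ * a * g⁻¹⁻¹, conj_mem_pClass g⁻¹ (mem_pClass.2 ⟨by rw [ha.1], ha.2⟩), ?_,
    fun n hn => ?_⟩
  · have h1 := hd.conj (g : Dˣ ⧸ N)⁻¹
    rw [← ha.1, ← hg.1] at h1
    simpa [mul_assoc] using h1
  · rw [← conj_mem_addSet_iff g]
    refine hab ?_
    have := conj_mem_addSet g hn
    simpa [mul_assoc] using this

theorem exists_isDistantPair (hneg : (-1 : Dˣ) ∈ N) (hne : ∀ a : Dˣ, (addSet N a).Nonempty)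
    {x y : Dˣ ⧸ N} (hd : DistGT 4 x y) : ∃ A B : ConjClasses (Dˣ ⧸ N), IsDistantPair N A B := by
  rcases (hd.far4.comparable hneg).exists_subset_or with h | h
  · exact ⟨_, _, isDistantPair_of_distGT hneg hne hd h⟩
  · exact ⟨_, _, isDistantPair_of_distGT hneg hne hd.symm h⟩

theorem exists_uHypothesis_of_isBalanced (hneg : (-1 : Dˣ) ∈ N)
    (hne : ∀ a : Dˣ, (addSet N a).Nonempty) (hb : IsBalanced (Dˣ ⧸ N)) :
    ∃ C : ConjClasses (Dˣ ⧸ N), C ≠ ConjClasses.mk 1 ∧ UHypothesis N (nClass N C) := by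
  obtain ⟨x, y, h1, h2, -, h4, h5⟩ := hb
  have hc := comparable_of_far hneg h4.far3 h5.far3
  have hs := subOneMem_of_far hneg h1.far3 h2.far3
  rcases hc.exists_subset_or with h | h
  · exact ⟨_, mk_ne_mk_one h1.2.1, uHypothesis_of_comparable hneg hne h1.2.1 hc hs h⟩
  · exact ⟨_, mk_ne_mk_one h1.1, uHypothesis_of_comparable hneg hne h1.1 hc.symm hs.symm h⟩

end Existence

end DivQuot

theorem mainTheorem6 {F : Type*} {D : Type*} [Field F] [DivisionRing D] [Algebra F D]
    [Algebra.IsCentral F D] [FiniteDimensional F D] (N : Subgroup Dˣ) [N.Normal]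
    [Finite (Dˣ ⧸ N)] [IsSimpleGroup (Dˣ ⧸ N)] (hna : ∃ x y : Dˣ ⧸ N, x * y ≠ y * x) :
    (4 < (DivQuot.commutingGraph (Dˣ ⧸ N)).ediam →
      (∃ A B : ConjClasses (Dˣ ⧸ N), DivQuot.IsDistantPair N A B) ∧
      ∀ A B : ConjClasses (Dˣ ⧸ N), DivQuot.IsDistantPair N A B →
        (DivQuot.kHat F N B).Nonempty) ∧
    (DivQuot.IsBalanced (Dˣ ⧸ N) →
      (∃ C : ConjClasses (Dˣ ⧸ N), DivQuot.IsBalancedClass N C) ∧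
      ∀ C : ConjClasses (Dˣ ⧸ N), DivQuot.IsBalancedClass N C →
        (DivQuot.kHat F N C).Nonempty) := by
  have hinf : Infinite F := DivQuot.infinite_of_not_commute hna
  have hneg := DivQuot.neg_one_mem_of_isSimpleGroup hna
  have hne := DivQuot.addSet_nonempty N fun f : Fˣ => DivQuot.algebraMap_mem hna f
  refine ⟨fun hd => ⟨?_, fun A B h => h.uHypothesis.kHat_nonempty F hna h.right_ne_one⟩,
    fun hb => ⟨?_, fun C h => h.uHypothesis.kHat_nonempty F hna h.ne_one⟩⟩
  · rw [← not_le, SimpleGraph.ediam_le_iff] at hd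
    push Not at hd
    obtain ⟨⟨x, hx⟩, ⟨y, hy⟩, hxy⟩ := hd
    exact DivQuot.exists_isDistantPair hneg hne (x := x) (y := y) ⟨hx, hy, hxy⟩
  · obtain ⟨C, hC, h⟩ := DivQuot.exists_uHypothesis_of_isBalanced hneg hne hb
    exact ⟨C, h.isBalancedClass F hna hC⟩
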